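/- All logarithms are to base $2$. Let $\mathcal X,\mathcal Y$ be finite alphabets, $\mu_X$ a distribution on $\mathcal X$, $\mu_{Y|X}$ a conditional distribution, $\mu_{XY}(x,y)=\mu_X(x)\mu_{Y|X}(y|x)$, with $H(Y|X)$, $I(X;Y)=H(Y)-H(Y|X)$ computed from $\mu_{XY}$, and $\mu_Y$ the marginal of $Y$. Let $\rho:\mathcal X\times\mathcal Y\to[0,\infty)$, $\rho_{\max}=\max_{x,y}\rho(x,y)$, $\rho_n(\boldsymbol x,\boldsymbol y)=\sum_{i=1}^n\rho(x_i,y_i)$. Let $X^n=(X_1,\dots,X_n)$ be i.i.d. with law $\mu_X$, and let $\mu_{Y|X}(\boldsymbol y|\boldsymbol x)=\prod_i\mu_{Y|X}(y_i|x_i)$, $\mu_Y(\boldsymbol y)=\prod_i\mu_Y(y_i)$. Put $$\zeta_{\mathcal Y}(\gamma)=\gamma-\sqrt{2\gamma}\,\log\frac{\sqrt{2\gamma}}{|\mathcal Y|},\qquad R_X(D)=\inf\{I(X;Y'):\ \mu_{Y'|X}\text{ with values in }\mathcal Y,\ E[\rho(X,Y')]\le D\}.$$ *Ensembles.* For every $n\geq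 1$ let $\mathcal A_n$ be a nonempty finite set of functions $A:\mathcal Y^n\to\overline{\mathcal U}_n$ ($\overline{\mathcal U}_n$ finite), $p_{A}$ a probability distribution on $\mathcal A_n$, and $\mathrm{Im}\mathcal A_n=\bigcup_{A\in\mathcal A_n}A(\mathcal Y^n)$. The sequence of ensembles has the *hash property* if $\frac1n\log\frac{|\overline{\mathcal U}_n|}{|\mathrm{Im}\mathcal A_n|}\to0$ and there are real sequences $\alpha(n)\to1$, $\beta(n)\to0$ such that for all $n\ge1$ and all $\mathcal T,\mathcal T'\subset\mathcal Y^n$ $$\sum_{\boldsymbol u\in\mathcal T,\,\boldsymbol u'\in\mathcal T'}p_A(\{A:A\boldsymbol u=A\boldsymbol u'\})\le|\mathcal T\cap\mathcal T'|+\frac{|\mathcal T||\mathcal T'|\alpha(n)}{|\mathrm{Im}\mathcal A_n|}+\min\{|\mathcal T|,|\mathcal T'|\}\beta(n).$$ *Code.* Let $\varepsilon_{\mathcal A},\varepsilon_{\mathcal B}>0$, and for every $n\ge1$ let $l_{\mathcal A}(n)$, $l_{\mathcal B}(n)$ be natural numbers obtained by rounding, up or down, $$\frac{n[H(Y|X)-\varepsilon_{\mathcal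 A}]}{\log|\mathcal Y|}\quad\text{and}\quad\frac{n[I(X;Y)+\varepsilon_{\mathcal B}]}{\log|\mathcal Y|}$$ (so a number that is already a natural number is kept; such lengths for all $n$ exist only if $|\mathcal Y|\ge2$ and $\varepsilon_{\mathcal A}\le H(Y|X)$). Let $(\mathcal A,p_A)$ and $(\mathcal B,p_B)$ be ensembles of functions $\mathcal Y^n\to\mathcal Y^{l_{\mathcal A}(n)}$ and $\mathcal Y^n\to\mathcal Y^{l_{\mathcal B}(n)}$. Given $A\in\mathcal A$, $B\in\mathcal B$, $\boldsymbol c\in\mathrm{Im}\mathcal A$, the encoder and decoder are $\varphi(\boldsymbol x)=B\,g_A(\boldsymbol c|\boldsymbol x)$ and $\varphi^{-1}(\boldsymbol b)=g_{AB}(\boldsymbol c,\boldsymbol b)$, where $$g_A(\boldsymbol c|\boldsymbol x)\in\arg\max_{\boldsymbol y':A\boldsymbol y'=\boldsymbol c}\mu_{Y|X}(\boldsymbol y'|\boldsymbol x),\qquad g_{AB}(\boldsymbol c,\boldsymbol b)\in\arg\max_{\boldsymbol y':A\boldsymbol y'=\boldsymbol c,\,B\boldsymbol y'=\boldsymbol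 b}\mu_Y(\boldsymbol y'),$$ with ties broken by any rules fixed in advance as functions of $(A,\boldsymbol c,\boldsymbol x)$ and $(A,B,\boldsymbol c,\boldsymbol b)$ respectively, and with arbitrary values in $\mathcal Y^n$ when the constraint set is empty. The rate is $R(B)=l_{\mathcal B}(n)\log|\mathcal Y|/n$. **Theorem.** (1) Assume that $\varepsilon_{\mathcal A}+2\zeta_{\mathcal Y}(3\varepsilon_{\mathcal A})<\varepsilon_{\mathcal B}$ and that $(\mathcal A,p_A)$ and $(\mathcal B,p_B)$ have the hash property. Then for all sufficiently large $n$, for all tie-breaking rules, there are $A\in\mathcal A$, $B\in\mathcal B$ and $\boldsymbol c\in\mathrm{Im}\mathcal A$ such that $R(B)=I(X;Y)+\varepsilon_{\mathcal B}$ up to the rounding of $l_{\mathcal B}$ (that is, $|R(B)-I(X;Y)-\varepsilon_{\mathcal B}|<\frac{\log|\mathcal Y|}n$, with $R(B)=I(X;Y)+\varepsilon_{\mathcal B}$ exactly whenever $n[I(X;Y)+\varepsilon_{\mathcal B}]/\log|\mathcal Y|$ is a natural number), and $$\frac{E[\rho_n(X^n,\varphi^{-1}(\varphi(X^n)))]}n\le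 E[\rho(X,Y)]+3|\mathcal X||\mathcal Y|\rho_{\max}\sqrt{\varepsilon_{\mathcal A}}.$$ (2) If $\mu_{Y|X}$ attains the rate-distortion bound at $D$, i.e. $E[\rho(X,Y)]\le D$ and $I(X;Y)=R_X(D)$, then the rate-distortion pair of the code is close to $(R_X(D),D)$ as $\varepsilon_{\mathcal A},\varepsilon_{\mathcal B}\to0$: for every $\delta>0$ there is $\varepsilon_0>0$ such that whenever $0<\varepsilon_{\mathcal A},\varepsilon_{\mathcal B}<\varepsilon_0$ and the assumptions of (1) hold, for all sufficiently large $n$ and all tie-breaking rules there are $A\in\mathcal A$, $B\in\mathcal B$, $\boldsymbol c\in\mathrm{Im}\mathcal A$ with $|R(B)-R_X(D)|\le\delta$ and $\frac1nE[\rho_n(X^n,\varphi^{-1}(\varphi(X^n)))]\le D+\delta$. Moreover, for every $\varepsilon_0>0$ there are $\varepsilon_{\mathcal A},\varepsilon_{\mathcal B}\in(0,\varepsilon_0)$ with $\varepsilon_{\mathcal A}+2\zeta_{\mathcal Y}(3\varepsilon_{\mathcal A})<\varepsilon_{\mathcal B}$. -/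

import Mathlib

open Filter Topology

noncomputable section

namespace LossyHash

/-! ### Information quantities of finite alphabets (logarithms to base 2)

Distributions are weight functions in Mathlib's `stdSimplex`. A channel `W : 𝒳 → 𝒴 → ℝ` is the
conditional distribution `W x y = μ_{Y|X}(y|x)`. -/

/-- The entropy `H(p) = ∑ u, p(u) log (1 / p(u))` (terms with `p(u) = 0` vanish). -/
def entropy {U : Type*} [Fintype U] (p : U → ℝ) : ℝ :=
  ∑ u, p u * Real.logb 2 (1 / p u)

/-- The conditional entropy `H(Y|X) = ∑ x y, μ_{Y|X}(y|x) μ_X(x) log (1 / μ_{Y|X}(y|x))`. -/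
def condEntropy {X Y : Type*} [Fintype X] [Fintype Y] (μ : X → ℝ) (W : X → Y → ℝ) : ℝ :=
  ∑ x, ∑ y, W x y * μ x * Real.logb 2 (1 / W x y)

/-- The output marginal `μ_Y(y) = ∑ x, μ_X(x) μ_{Y|X}(y|x)`. -/
def outputDist {X Y : Type*} [Fintype X] (μ : X → ℝ) (W : X → Y → ℝ) (y : Y) : ℝ :=
  ∑ x, μ x * W x y

/-- The mutual information `I(Y;X) = H(Y) - H(Y|X)`. -/
def mutualInfo {X Y : Type*} [Fintype X] [Fintype Y] (μ : X → ℝ) (W : X → Y → ℝ) : ℝ :=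
  entropy (outputDist μ W) - condEntropy μ W

/-- `ζ_𝒰(γ) = γ - √(2γ) log (√(2γ) / |𝒰|)`. -/
def zeta (U : Type*) [Fintype U] (γ : ℝ) : ℝ :=
  γ - Real.sqrt (2 * γ) * Real.logb 2 (Real.sqrt (2 * γ) / (Fintype.card U : ℝ))

/-- The memoryless law `μ(u₁) ⋯ μ(uₙ)` of a sequence. -/
def iidProb {U : Type*} {n : ℕ} (μ : U → ℝ) (u : Fin n → U) : ℝ :=
  ∏ i, μ (u i)

/-- The memoryless conditional law `μ_{Y|X}(y₁|x₁) ⋯ μ_{Y|X}(yₙ|xₙ)`. -/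
def channelProb {X Y : Type*} {n : ℕ} (W : X → Y → ℝ) (x : Fin n → X) (y : Fin n → Y) : ℝ :=
  ∏ i, W (x i) (y i)

/-! ### Distortion -/

/-- `E[ρ(X,Y)]` for the joint distribution `μ_X(x) μ_{Y|X}(y|x)`. -/
def expDist {X Y : Type*} [Fintype X] [Fintype Y] (μ : X → ℝ) (W : X → Y → ℝ)
    (ρ : X → Y → ℝ) : ℝ :=
  ∑ x, ∑ y, μ x * W x y * ρ x y

/-- `ρ_max = max_{x,y} ρ(x,y)`. -/
def rhoMax {X Y : Type*} (ρ : X → Y → ℝ) : ℝ :=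
  ⨆ z : X × Y, ρ z.1 z.2

/-- `ρ_n(x,y) = ∑ i, ρ(xᵢ,yᵢ)`. -/
def blockDist {X Y : Type*} {n : ℕ} (ρ : X → Y → ℝ) (x : Fin n → X) (y : Fin n → Y) : ℝ :=
  ∑ i, ρ (x i) (y i)

/-- The expected per-letter distortion `E[ρ_n(Xⁿ, ψ(φ(Xⁿ)))] / n` of the code with encoder `φ` and
decoder `ψ` for the memoryless source with letter distribution `μ`. -/
def codeDistortion {X Y M : Type*} [Fintype X] {n : ℕ} (μ : X → ℝ) (ρ : X → Y → ℝ)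
    (φ : (Fin n → X) → M) (ψ : M → (Fin n → Y)) : ℝ :=
  (∑ x : Fin n → X, iidProb μ x * blockDist ρ x (ψ (φ x))) / n

/-- The rate-distortion function: the infimum of `I(X;Y)` over all conditional distributions with
`E[ρ(X,Y)] ≤ D`. -/
def rateDistortion {X Y : Type*} [Fintype X] [Fintype Y] (μ : X → ℝ) (ρ : X → Y → ℝ)
    (D : ℝ) : ℝ :=
  sInf {r : ℝ | ∃ V : X → Y → ℝ, (∀ x, V x ∈ stdSimplex ℝ Y) ∧ expDist μ V ρ ≤ D ∧
    r = mutualInfo μ V}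

/-- `μ_{Y|X} = W` attains the rate-distortion bound at distortion level `D`. -/
def AttainsRD {X Y : Type*} [Fintype X] [Fintype Y] (μ : X → ℝ) (W : X → Y → ℝ)
    (ρ : X → Y → ℝ) (D : ℝ) : Prop :=
  expDist μ W ρ ≤ D ∧ mutualInfo μ W = rateDistortion μ ρ D

/-! ### Ensembles of functions and the hash property -/

/-- An ensemble: a finite set of functions with a probability distribution on it. -/
structure Ensemble (D R : Type*) where
  carrier : Finset (D → R)
  prob : (D → R) → ℝ
  prob_nonneg : ∀ A ∈ carrier, 0 ≤ prob A
  prob_sum : ∑ A ∈ carrier, prob A = 1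

/-- `Im 𝒜`, the union of the images of the functions in the set. -/
def Ensemble.im {D R : Type*} (E : Ensemble D R) : Set R :=
  {c | ∃ A ∈ E.carrier, ∃ u, A u = c}

open Classical in
/-- `p_A({A : A u = A u'})`. -/
def Ensemble.collisionProb {D R : Type*} (E : Ensemble D R) (u u' : D) : ℝ :=
  ∑ A ∈ E.carrier with A u = A u', E.prob A

open Classical in
/-- The `(α, β)`-hash property of a sequence (in the block length `n`) of ensembles of functions
`𝒰ⁿ → R n`. -/
def HasHashProperty {U : Type*} {R : ℕ → Type*} [∀ n, Fintype (R n)]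
    (E : ∀ n, Ensemble (Fin n → U) (R n)) (α β : ℕ → ℝ) : Prop :=
  Tendsto (fun n : ℕ =>
    Real.logb 2 ((Fintype.card (R n) : ℝ) / ((E n).im.ncard : ℝ)) / n) atTop (𝓝 0) ∧
  Tendsto α atTop (𝓝 1) ∧
  Tendsto β atTop (𝓝 0) ∧
  ∀ n : ℕ, 1 ≤ n → ∀ T T' : Finset (Fin n → U),
    ∑ u ∈ T, ∑ u' ∈ T', (E n).collisionProb u u' ≤
      ((T ∩ T').card : ℝ) + (T.card : ℝ) * (T'.card : ℝ) * α n / ((E n).im.ncard : ℝ)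
        + min (T.card : ℝ) (T'.card : ℝ) * β n

/-! ### The code -/

/-- `l n` is the real number `n r / log |𝒴|` rounded, up or down, to a natural number (so it is
that number whenever that number is a natural number). -/
def IsBlockLength (Y : Type*) [Fintype Y] (l : ℕ → ℕ) (r : ℝ) : Prop :=
  ∀ n : ℕ, 1 ≤ n →
    |(l n : ℝ) * Real.logb 2 (Fintype.card Y : ℝ) - n * r| < Real.logb 2 (Fintype.card Y : ℝ)

/-- The rate `l log |𝒴| / n`. -/
def codeRate (Y : Type*) [Fintype Y] (n l : ℕ) : ℝ :=
  (l : ℝ) * Real.logb 2 (Fintype.card Y : ℝ) / n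

/-- `g A c x` is a point of `argmax_{y' : A y' = c} μ_{Y|X}(y'|x)`, for all `A`, `c`, `x` for which
`{y' : A y' = c}` is nonempty. -/
def IsEncoderArgmax {X Y C : Type*} {n : ℕ} (W : X → Y → ℝ)
    (g : ((Fin n → Y) → C) → C → (Fin n → X) → (Fin n → Y)) : Prop :=
  ∀ A c x, (∃ y, A y = c) →
    A (g A c x) = c ∧ ∀ y, A y = c → channelProb W x y ≤ channelProb W x (g A c x)

/-- `g A B c b` is a point of `argmax_{y' : A y' = c, B y' = b} μ_Y(y')`, for all `A`, `B`, `c`, `b`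
for which `{y' : A y' = c, B y' = b}` is nonempty. -/
def IsDecoderArgmax {Y C M : Type*} {n : ℕ} (μY : Y → ℝ)
    (g : ((Fin n → Y) → C) → ((Fin n → Y) → M) → C → M → (Fin n → Y)) : Prop :=
  ∀ A B c b, (∃ y, A y = c ∧ B y = b) →
    (A (g A B c b) = c ∧ B (g A B c b) = b) ∧
      ∀ y, A y = c → B y = b → iidProb μY y ≤ iidProb μY (g A B c b)

end LossyHash

end

namespace LossyHash

/-! The argument is random coding: the error probability is averaged over `A`, `B` and a uniform `c`
in the image of `𝒜`, and a good triple is then fixed. Write `h` and `H` for the conditional and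
output entropies in nats, `e` and `e'` for `εA` and `εB` times `log 2`.

For an input `x` nothing goes wrong unless one of three events occurs (`CodingError`). (i) The fibre
of `A` over `c` misses the conditionally typical set. That set has about `exp (n h)` points and the
image of `𝒜` only about `exp (n (h - e))`, so the second-moment saturation bound makes this rare.
(ii) The fibre contains a sequence as likely as a typical one that has large distortion or small
output probability. The maximizer need not be typical, so such sequences must be absent from the
whole fibre. Their expected number is about `exp (n e)` times the probability of a bad pair. The
Chernoff bounds make the latter at most `2 exp (-1.5 n εA)`, and `e < 0.7 εA`. (iii) Another
sequence of output probability at least `exp (-n (H + k))` agrees with the encoder's choice under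
`A` and `B`. There are at most `exp (n (H + k))` of these against about `exp (n (H - e + e'))` hash
values, so `e + k < e'` suffices. With `k` equal to `2 ζ(3 εA) log 2` this is the hypothesis on `εA`
and `εB`.

Outside these events maximum likelihood decoding returns the encoder's point, whose distortion is
controlled (`codeDistortion_le_add`). The one-shot bound is `exists_sum_codingError_le`; the
exponents are compared in `eventually_exists_error_le`. -/

open Classical in
/-- The number of points of `T` that `A` sends to `c`. -/
noncomputable def fiberCard {D R : Type*} (T : Finset D) (A : D → R) (c : R) : ℕ :=
  (T.filter fun u => A u = c).card

open Classical in
/-- The image of an ensemble with finite range, as a `Finset`. -/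
noncomputable def Ensemble.imFinset {D R : Type*} [Fintype R] (E : Ensemble D R) : Finset R :=
  Finset.univ.filter fun c => c ∈ E.im

/-! ### Averages over an ensemble: saturation and collision resistance -/

section Ensemble

variable {D R : Type*} (E : Ensemble D R)

theorem Ensemble.exists_le_of_average_le {F : (D → R) → ℝ} {δ : ℝ}
    (h : ∑ A ∈ E.carrier, E.prob A * F A ≤ δ) : ∃ A ∈ E.carrier, F A ≤ δ := by
  by_contra! hc
  obtain ⟨A₀, hA₀, hpos⟩ : ∃ A ∈ E.carrier, 0 < E.prob A := by
    by_contra! hn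
    have := Finset.sum_nonpos hn
    rw [E.prob_sum] at this
    linarith
  have hlt : ∑ A ∈ E.carrier, E.prob A * δ < ∑ A ∈ E.carrier, E.prob A * F A :=
    Finset.sum_lt_sum
      (fun A hA => mul_le_mul_of_nonneg_left (hc A hA).le (E.prob_nonneg A hA))
      ⟨A₀, hA₀, mul_lt_mul_of_pos_left (hc A₀ hA₀) hpos⟩
  rw [← Finset.sum_mul, E.prob_sum] at hlt
  linarith

theorem Ensemble.average_le {F : (D → R) → ℝ} {δ : ℝ} (h : ∀ A ∈ E.carrier, F A ≤ δ) :
    ∑ A ∈ E.carrier, E.prob A * F A ≤ δ := by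
  calc ∑ A ∈ E.carrier, E.prob A * F A ≤ ∑ A ∈ E.carrier, E.prob A * δ :=
        Finset.sum_le_sum fun A hA => mul_le_mul_of_nonneg_left (h A hA) (E.prob_nonneg A hA)
    _ = δ := by rw [← Finset.sum_mul, E.prob_sum, one_mul]

theorem Ensemble.carrier_nonempty : E.carrier.Nonempty := by
  rw [Finset.nonempty_iff_ne_empty]
  intro h
  have := E.prob_sum
  simp [h] at this

open Classical in
theorem Ensemble.collisionProb_eq (u u' : D) :
    E.collisionProb u u' = ∑ A ∈ E.carrier, E.prob A * (if A u = A u' then 1 else 0) := by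
  simp [Ensemble.collisionProb, Finset.sum_filter]

variable [Fintype R]

theorem Ensemble.mem_imFinset {c : R} : c ∈ E.imFinset ↔ c ∈ E.im := by
  simp [Ensemble.imFinset]

theorem Ensemble.ncard_im : E.im.ncard = E.imFinset.card := by
  rw [← Set.ncard_coe_finset]
  congr 1
  ext c
  simp [E.mem_imFinset]

theorem Ensemble.apply_mem_imFinset {A : D → R} (hA : A ∈ E.carrier) (u : D) :
    A u ∈ E.imFinset :=
  E.mem_imFinset.2 ⟨A, hA, u, rfl⟩

theorem Ensemble.imFinset_card_pos [Nonempty D] : 0 < E.imFinset.card := by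
  obtain ⟨A, hA⟩ := E.carrier_nonempty
  exact Finset.card_pos.2 ⟨_, E.apply_mem_imFinset hA (Classical.arbitrary D)⟩

theorem Ensemble.sum_fiberCard (T : Finset D) {A : D → R} (hA : A ∈ E.carrier) :
    ∑ c ∈ E.imFinset, (fiberCard T A c : ℝ) = T.card := by
  classical
  rw [Finset.card_eq_sum_card_fiberwise (f := A) (t := E.imFinset)
    (fun u _ => E.apply_mem_imFinset hA u)]
  push_cast
  rfl

open Classical in
theorem Ensemble.sum_fiberCard_sq (T : Finset D) {A : D → R} (hA : A ∈ E.carrier) :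
    ∑ c ∈ E.imFinset, (fiberCard T A c : ℝ) ^ 2
      = ∑ u ∈ T, ∑ u' ∈ T, if A u = A u' then (1 : ℝ) else 0 := by
  have h1 : ∀ u ∈ T, (∑ u' ∈ T, if A u = A u' then (1 : ℝ) else 0) = fiberCard T A (A u) := by
    intro u _
    simp [fiberCard, eq_comm]
  rw [Finset.sum_congr rfl h1,
    ← Finset.sum_fiberwise_of_maps_to (fun u _ => E.apply_mem_imFinset hA u)
      (fun u => (fiberCard T A (A u) : ℝ))]
  refine Finset.sum_congr rfl fun c _ => ?_
  rw [Finset.sum_congr rfl (g := fun _ => (fiberCard T A c : ℝ))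
    (fun u hu => by rw [(Finset.mem_filter.1 hu).2])]
  rw [Finset.sum_const, nsmul_eq_mul, sq]
  rfl

open Classical in
/-- Saturation: a set `T` that is large compared to the image of the ensemble meets the preimage
`A⁻¹(c)` for most pairs `(A, c)`. -/
theorem Ensemble.average_disjoint_le [Nonempty D] {α β : ℝ} (T : Finset D) (hT : T.Nonempty)
    (hash : ∑ u ∈ T, ∑ u' ∈ T, E.collisionProb u u' ≤
      T.card + (T.card : ℝ) * T.card * α / E.imFinset.card + T.card * β) :
    ∑ A ∈ E.carrier, E.prob A * ∑ c ∈ E.imFinset, (if ∀ u ∈ T, A u ≠ c then (1 : ℝ) else 0)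
      ≤ E.imFinset.card * (α - 1 + E.imFinset.card * (1 + β) / T.card) := by
  have ht : (0 : ℝ) < T.card := by exact_mod_cast Finset.card_pos.2 hT
  have hm : (0 : ℝ) < E.imFinset.card := by exact_mod_cast E.imFinset_card_pos
  set t : ℝ := (T.card : ℝ)
  set m : ℝ := (E.imFinset.card : ℝ) with hm_def
  -- Double counting: the squared fibre sizes add up to the number of colliding ordered pairs.
  have hcoll : ∑ u ∈ T, ∑ u' ∈ T, E.collisionProb u u'
      = ∑ A ∈ E.carrier, E.prob A * ∑ c ∈ E.imFinset, (fiberCard T A c : ℝ) ^ 2 := by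
    have h : ∀ A ∈ E.carrier, E.prob A * ∑ c ∈ E.imFinset, (fiberCard T A c : ℝ) ^ 2
        = ∑ u ∈ T, ∑ u' ∈ T, E.prob A * (if A u = A u' then 1 else 0) := fun A hA => by
      simp_rw [E.sum_fiberCard_sq T hA, Finset.mul_sum]
    rw [Finset.sum_congr rfl h]
    simp_rw [E.collisionProb_eq]
    exact (Finset.sum_congr rfl fun u _ => Finset.sum_comm).trans Finset.sum_comm
  have hA : ∀ A ∈ E.carrier,
      ∑ c ∈ E.imFinset, (if ∀ u ∈ T, A u ≠ c then (1 : ℝ) else 0)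
        ≤ -m + m ^ 2 / t ^ 2 * ∑ c ∈ E.imFinset, (fiberCard T A c : ℝ) ^ 2 := by
    intro A hA
    -- Chebyshev: the mean fibre size is `t / m`, and an empty fibre has squared relative deviation
    -- exactly 1.
    have hpt : ∀ c ∈ E.imFinset, (if ∀ u ∈ T, A u ≠ c then (1 : ℝ) else 0)
        ≤ 1 - 2 * m / t * fiberCard T A c + m ^ 2 / t ^ 2 * (fiberCard T A c : ℝ) ^ 2 := by
      intro c _
      have hsq : 1 - 2 * m / t * fiberCard T A c + m ^ 2 / t ^ 2 * (fiberCard T A c : ℝ) ^ 2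
          = (1 - m / t * fiberCard T A c) ^ 2 := by ring
      rw [hsq]
      split_ifs with h
      · have : fiberCard T A c = 0 := by
          rw [fiberCard, Finset.card_eq_zero, Finset.filter_eq_empty_iff]
          exact h
        simp [this]
      · positivity
    refine (Finset.sum_le_sum hpt).trans (le_of_eq ?_)
    rw [Finset.sum_add_distrib, Finset.sum_sub_distrib, ← Finset.mul_sum, ← Finset.mul_sum,
      E.sum_fiberCard T hA, Finset.sum_const, nsmul_eq_mul, ← hm_def]
    field_simp
    ring
  calc _ ≤ ∑ A ∈ E.carrier, E.prob A *
          (-m + m ^ 2 / t ^ 2 * ∑ c ∈ E.imFinset, (fiberCard T A c : ℝ) ^ 2) :=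
        Finset.sum_le_sum fun A h => mul_le_mul_of_nonneg_left (hA A h) (E.prob_nonneg A h)
    _ = -m + m ^ 2 / t ^ 2 * ∑ u ∈ T, ∑ u' ∈ T, E.collisionProb u u' := by
        rw [hcoll, Finset.mul_sum]
        simp_rw [mul_add]
        rw [Finset.sum_add_distrib, ← Finset.sum_mul, E.prob_sum, one_mul]
        congr 1
        exact Finset.sum_congr rfl fun A _ => by ring
    _ ≤ -m + m ^ 2 / t ^ 2 * (t + t * t * α / m + t * β) := by gcongr
    _ = m * (α - 1 + m * (1 + β) / t) := by field_simp; ring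

open Classical in
theorem Ensemble.sum_exists_mem_le (S : Finset D) {A : D → R} (hA : A ∈ E.carrier) :
    ∑ c ∈ E.imFinset, (if ∃ u ∈ S, A u = c then (1 : ℝ) else 0) ≤ S.card := by
  rw [← E.sum_fiberCard S hA]
  refine Finset.sum_le_sum fun c _ => ?_
  split_ifs with h
  · obtain ⟨u, hu, hc⟩ := h
    have : 0 < fiberCard S A c := Finset.card_pos.2 ⟨u, Finset.mem_filter.2 ⟨hu, hc⟩⟩
    exact_mod_cast this
  · positivity

open Classical in
/-- Collision resistance: a point is rarely hashed together with another point of a small set. -/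
theorem Ensemble.average_exists_collision_le {α β : ℝ}
    (hash : ∀ (u : D) (S : Finset D), u ∉ S →
      ∑ u' ∈ S, E.collisionProb u u' ≤ S.card * |α| / E.imFinset.card + |β|)
    (u : D) (S : Finset D) :
    ∑ B ∈ E.carrier, E.prob B * (if ∃ u' ∈ S, u' ≠ u ∧ B u' = B u then (1 : ℝ) else 0)
      ≤ S.card * |α| / E.imFinset.card + |β| := by
  have h1 : ∀ B : D → R, (if ∃ u' ∈ S, u' ≠ u ∧ B u' = B u then (1 : ℝ) else 0)
      ≤ ∑ u' ∈ S.erase u, if B u = B u' then (1 : ℝ) else 0 := by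
    intro B
    split_ifs with h
    · obtain ⟨u', hu', hne, hB⟩ := h
      have := Finset.single_le_sum (s := S.erase u)
        (f := fun u' => if B u = B u' then (1 : ℝ) else 0)
        (fun i _ => by positivity) (Finset.mem_erase.2 ⟨hne, hu'⟩)
      simpa [hB] using this
    · exact Finset.sum_nonneg fun i _ => by positivity
  calc _ ≤ ∑ B ∈ E.carrier, E.prob B * ∑ u' ∈ S.erase u, (if B u = B u' then (1 : ℝ) else 0) :=
        Finset.sum_le_sum fun B hB => mul_le_mul_of_nonneg_left (h1 B) (E.prob_nonneg B hB)
    _ = ∑ u' ∈ S.erase u, E.collisionProb u u' := by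
        simp_rw [E.collisionProb_eq, Finset.mul_sum]
        rw [Finset.sum_comm]
    _ ≤ (S.erase u).card * |α| / E.imFinset.card + |β| := hash u _ (Finset.notMem_erase u S)
    _ ≤ _ := by
        gcongr
        exact Finset.erase_subset u S

end Ensemble

/-! ### The one-shot error bound -/

/-- The error event of the source code given by `A`, `B`, `c` on the input `x`: no point of `T x`, or
some point of `S x`, satisfies the constraint of the encoder, or some other point of `G` has the same
image under `A` and `B` as the point chosen by the encoder. -/
def CodingError {X D C M : Type*} (T S : X → Finset D) (G : Finset D)
    (g : (D → C) → C → X → D) (A : D → C) (B : D → M) (c : C) (x : X) : Prop :=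
  (∀ y ∈ T x, A y ≠ c) ∨ (∃ y ∈ S x, A y = c) ∨
    ∃ y' ∈ G, y' ≠ g A c x ∧ A y' = c ∧ B y' = B (g A c x)

open Classical in
/-- The one-shot bound on the error probability for the best choice of `A`, `B` and `c`. -/
theorem exists_sum_codingError_le {X D C M : Type*} [Fintype X] [Nonempty D] [Fintype C]
    [Fintype M] (p : X → ℝ) (hp0 : ∀ x, 0 ≤ p x) (hp1 : ∑ x, p x = 1)
    (EA : Ensemble D C) (EB : Ensemble D M) {α β α' β' : ℝ}
    (hashA : ∀ T : Finset D, ∑ u ∈ T, ∑ u' ∈ T, EA.collisionProb u u' ≤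
      T.card + (T.card : ℝ) * T.card * α / EA.imFinset.card + T.card * β)
    (hashB : ∀ (u : D) (S : Finset D), u ∉ S →
      ∑ u' ∈ S, EB.collisionProb u u' ≤ S.card * |α'| / EB.imFinset.card + |β'|)
    (g : (D → C) → C → X → D) (T S : X → Finset D) (G : Finset D) {t : ℝ} (ht : 0 < t) :
    ∃ A ∈ EA.carrier, ∃ B ∈ EB.carrier, ∃ c ∈ EA.im,
      ∑ x, p x * (if CodingError T S G g A B c x then 1 else 0) ≤
        ∑ x with ((T x).card : ℝ) < t, p x + |α - 1| + EA.imFinset.card * (1 + |β|) / t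
          + (∑ x, p x * (S x).card) / EA.imFinset.card
          + (G.card * |α'| / (EA.imFinset.card * EB.imFinset.card) + |β'|) := by
  have hm : (0 : ℝ) < EA.imFinset.card := by exact_mod_cast EA.imFinset_card_pos
  have hm' : (0 : ℝ) < EB.imFinset.card := by exact_mod_cast EB.imFinset_card_pos
  set m : ℝ := (EA.imFinset.card : ℝ) with hm_def
  set m' : ℝ := (EB.imFinset.card : ℝ) with hm'_def
  set δ : ℝ := ∑ x with ((T x).card : ℝ) < t, p x + |α - 1| + m * (1 + |β|) / t
          + (∑ x, p x * (S x).card) / m + (G.card * |α'| / (m * m') + |β'|) with hδ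
  let e₁ : (D → C) → C → X → ℝ := fun A c x => if ∀ y ∈ T x, A y ≠ c then 1 else 0
  let e₂ : (D → C) → C → X → ℝ := fun A c x => if ∃ y ∈ S x, A y = c then 1 else 0
  let e₃ : (D → C) → (D → M) → C → X → ℝ := fun A B c x =>
    if ∃ y' ∈ G.filter (fun y => A y = c), y' ≠ g A c x ∧ B y' = B (g A c x) then 1 else 0
  have herr : ∀ A B c x, (if CodingError T S G g A B c x then (1 : ℝ) else 0)
      ≤ e₁ A c x + e₂ A c x + e₃ A B c x := by
    intro A B c x
    have h1 : 0 ≤ e₁ A c x := by simp only [e₁]; positivity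
    have h2 : 0 ≤ e₂ A c x := by simp only [e₂]; positivity
    have h3 : 0 ≤ e₃ A B c x := by simp only [e₃]; positivity
    split_ifs with h
    · rcases h with h | h | ⟨y', hy', hne, hA, hB⟩
      · have : e₁ A c x = 1 := if_pos h
        linarith
      · have : e₂ A c x = 1 := if_pos h
        linarith
      · have : e₃ A B c x = 1 := if_pos ⟨y', Finset.mem_filter.2 ⟨hy', hA⟩, hne, hB⟩
        linarith
    · linarith
  -- Saturation needs `T x` large; the inputs with small `T x` are charged the trivial bound 1 per
  -- value of `c`.
  have hb₁ : ∀ x, ∑ A ∈ EA.carrier, EA.prob A * ∑ c ∈ EA.imFinset, e₁ A c x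
      ≤ m * ((if ((T x).card : ℝ) < t then 1 else 0) + (|α - 1| + m * (1 + |β|) / t)) := by
    intro x
    split_ifs with h
    · have : ∑ A ∈ EA.carrier, EA.prob A * ∑ c ∈ EA.imFinset, e₁ A c x ≤ m := by
        refine EA.average_le fun A _ => ?_
        calc ∑ c ∈ EA.imFinset, e₁ A c x ≤ ∑ c ∈ EA.imFinset, (1 : ℝ) :=
              Finset.sum_le_sum fun c _ => by simp only [e₁]; split_ifs <;> norm_num
          _ = m := by simp [hm_def]
      refine this.trans (le_mul_of_one_le_right hm.le ?_)
      have : 0 ≤ |α - 1| + m * (1 + |β|) / t := by positivity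
      linarith
    · push Not at h
      have hne : (T x).Nonempty := by
        rw [← Finset.card_pos]
        exact_mod_cast ht.trans_le h
      refine (EA.average_disjoint_le (T x) hne (hashA _)).trans ?_
      rw [zero_add, ← hm_def]
      have : m * (1 + β) / (T x).card ≤ m * (1 + |β|) / t := by
        have : 1 + β ≤ 1 + |β| := by linarith [le_abs_self β]
        gcongr
      gcongr
      exact le_abs_self _
  have hb₂ : ∀ x, ∑ A ∈ EA.carrier, EA.prob A * ∑ c ∈ EA.imFinset, e₂ A c x ≤ (S x).card :=
    fun x => EA.average_le fun A hA => EA.sum_exists_mem_le (S x) hA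
  -- The encoder's point does not depend on `B`, so for fixed `A` and `c` collision resistance
  -- applies to the part of `G` in the fibre over `c`. These parts partition `G`, which gains the
  -- factor `1 / m` after averaging over `c`.
  have hb₃ : ∀ x, ∀ A ∈ EA.carrier,
      ∑ B ∈ EB.carrier, EB.prob B * ∑ c ∈ EA.imFinset, e₃ A B c x
        ≤ m * (G.card * |α'| / (m * m') + |β'|) := by
    intro x A hA
    have hcomm : ∑ B ∈ EB.carrier, EB.prob B * ∑ c ∈ EA.imFinset, e₃ A B c x
        = ∑ c ∈ EA.imFinset, ∑ B ∈ EB.carrier, EB.prob B * e₃ A B c x := by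
      simp_rw [Finset.mul_sum]
      exact Finset.sum_comm
    rw [hcomm]
    calc _ ≤ ∑ c ∈ EA.imFinset, ((fiberCard G A c : ℝ) * |α'| / m' + |β'|) :=
          Finset.sum_le_sum fun c _ => EB.average_exists_collision_le hashB (g A c x)
            (G.filter fun y => A y = c)
      _ = _ := by
          rw [Finset.sum_add_distrib, ← Finset.sum_div, ← Finset.sum_mul, EA.sum_fiberCard G hA,
            Finset.sum_const, nsmul_eq_mul, ← hm_def]
          field_simp
  have htotal : ∑ A ∈ EA.carrier, EA.prob A * ∑ B ∈ EB.carrier, EB.prob B *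
      ∑ c ∈ EA.imFinset, ∑ x, p x * (if CodingError T S G g A B c x then (1 : ℝ) else 0)
      ≤ m * δ := by
    have hB : ∀ A ∈ EA.carrier, ∑ B ∈ EB.carrier, EB.prob B *
        ∑ c ∈ EA.imFinset, ∑ x, p x * (if CodingError T S G g A B c x then (1 : ℝ) else 0)
        ≤ ∑ x, p x * (∑ c ∈ EA.imFinset, e₁ A c x + ∑ c ∈ EA.imFinset, e₂ A c x
          + m * (G.card * |α'| / (m * m') + |β'|)) := by
      intro A hA
      calc _ ≤ ∑ B ∈ EB.carrier, EB.prob B *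
            ∑ c ∈ EA.imFinset, ∑ x, p x * (e₁ A c x + e₂ A c x + e₃ A B c x) := by
            refine Finset.sum_le_sum fun B hB => mul_le_mul_of_nonneg_left ?_
              (EB.prob_nonneg B hB)
            exact Finset.sum_le_sum fun c _ => Finset.sum_le_sum fun x _ =>
              mul_le_mul_of_nonneg_left (herr A B c x) (hp0 x)
        _ = ∑ B ∈ EB.carrier, ∑ x, p x * (EB.prob B * (∑ c ∈ EA.imFinset, e₁ A c x
              + ∑ c ∈ EA.imFinset, e₂ A c x + ∑ c ∈ EA.imFinset, e₃ A B c x)) := by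
            refine Finset.sum_congr rfl fun B _ => ?_
            rw [Finset.sum_comm, Finset.mul_sum]
            refine Finset.sum_congr rfl fun x _ => ?_
            rw [← Finset.mul_sum, Finset.sum_add_distrib, Finset.sum_add_distrib]
            ring
        _ = ∑ x, p x * (∑ B ∈ EB.carrier, EB.prob B * (∑ c ∈ EA.imFinset, e₁ A c x
              + ∑ c ∈ EA.imFinset, e₂ A c x + ∑ c ∈ EA.imFinset, e₃ A B c x)) := by
            simp_rw [Finset.mul_sum (s := EB.carrier)]
            exact Finset.sum_comm
        _ ≤ _ := by
            refine Finset.sum_le_sum fun x _ => mul_le_mul_of_nonneg_left ?_ (hp0 x)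
            simp_rw [mul_add]
            rw [Finset.sum_add_distrib, Finset.sum_add_distrib, ← Finset.sum_mul,
              ← Finset.sum_mul, EB.prob_sum, one_mul, one_mul, ← mul_add]
            gcongr
            exact hb₃ x A hA
    calc _ ≤ ∑ A ∈ EA.carrier, EA.prob A * ∑ x, p x * (∑ c ∈ EA.imFinset, e₁ A c x
            + ∑ c ∈ EA.imFinset, e₂ A c x + m * (G.card * |α'| / (m * m') + |β'|)) :=
          Finset.sum_le_sum fun A hA => mul_le_mul_of_nonneg_left (hB A hA) (EA.prob_nonneg A hA)
      _ = ∑ x, p x * (∑ A ∈ EA.carrier, EA.prob A * (∑ c ∈ EA.imFinset, e₁ A c x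
            + ∑ c ∈ EA.imFinset, e₂ A c x + m * (G.card * |α'| / (m * m') + |β'|))) := by
          simp_rw [Finset.mul_sum (s := EA.carrier)]
          rw [Finset.sum_comm]
          refine Finset.sum_congr rfl fun A _ => ?_
          rw [Finset.mul_sum]
          exact Finset.sum_congr rfl fun x _ => by ring
      _ ≤ ∑ x, p x * (m * ((if ((T x).card : ℝ) < t then 1 else 0)
            + (|α - 1| + m * (1 + |β|) / t)) + (S x).card
            + m * (G.card * |α'| / (m * m') + |β'|)) := by
          refine Finset.sum_le_sum fun x _ => mul_le_mul_of_nonneg_left ?_ (hp0 x)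
          have h := hb₁ x
          have h' := hb₂ x
          simp_rw [mul_add (EA.prob _)]
          rw [Finset.sum_add_distrib, Finset.sum_add_distrib, ← Finset.sum_mul, EA.prob_sum]
          linarith
      _ = m * δ := by
          have hi : ∑ x with ((T x).card : ℝ) < t, p x
              = ∑ x, p x * (if ((T x).card : ℝ) < t then 1 else 0) := by
            simp [Finset.sum_filter]
          have hx : ∀ x, p x * (m * ((if ((T x).card : ℝ) < t then 1 else 0)
              + (|α - 1| + m * (1 + |β|) / t)) + (S x).card
              + m * (G.card * |α'| / (m * m') + |β'|))
              = m * (p x * (if ((T x).card : ℝ) < t then 1 else 0)) + p x * (S x).card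
                + p x * (m * (|α - 1| + m * (1 + |β|) / t)
                + m * (G.card * |α'| / (m * m') + |β'|)) := fun x => by ring
          simp_rw [hx]
          rw [Finset.sum_add_distrib, Finset.sum_add_distrib, ← Finset.mul_sum, ← Finset.sum_mul,
            hp1, hδ, hi]
          field_simp
          ring
  -- The three choices are made in turn, each no worse than its average.
  obtain ⟨A, hA, hA'⟩ := EA.exists_le_of_average_le htotal
  obtain ⟨B, hB, hB'⟩ := EB.exists_le_of_average_le hA'
  obtain ⟨c, hc, hc'⟩ := Finset.exists_le_of_sum_le (s := EA.imFinset) (g := fun _ => δ)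
    (Finset.card_pos.1 EA.imFinset_card_pos) (hB'.trans_eq (by simp [hm_def]))
  exact ⟨A, hA, B, hB, c, EA.mem_imFinset.1 hc, hc'⟩

/-! ### Exponential moments and Chernoff bounds for memoryless pairs -/

section Chernoff

variable {X Y : Type*} [Fintype X] [Fintype Y]

theorem sum_iidProb_mul_channelProb_mul_exp (n : ℕ) (μ : X → ℝ) (W : X → Y → ℝ)
    (f : X → Y → ℝ) :
    ∑ x : Fin n → X, ∑ y : Fin n → Y,
      iidProb μ x * channelProb W x y * Real.exp (∑ i, f (x i) (y i))
      = (∑ a, ∑ b, μ a * W a b * Real.exp (f a b)) ^ n := by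
  classical
  have h1 : ∀ (x : Fin n → X) (y : Fin n → Y),
      iidProb μ x * channelProb W x y * Real.exp (∑ i, f (x i) (y i))
        = ∏ i, (μ (x i) * W (x i) (y i) * Real.exp (f (x i) (y i))) := by
    intro x y
    rw [Real.exp_sum, iidProb, channelProb, ← Finset.prod_mul_distrib, ← Finset.prod_mul_distrib]
  simp_rw [h1]
  have h2 : ∀ x : Fin n → X,
      ∑ y : Fin n → Y, ∏ i, (μ (x i) * W (x i) (y i) * Real.exp (f (x i) (y i)))
        = ∏ i, ∑ b, (μ (x i) * W (x i) b * Real.exp (f (x i) b)) := by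
    intro x
    rw [Finset.prod_univ_sum, Fintype.piFinset_univ]
  simp_rw [h2]
  have h3 := Finset.prod_univ_sum (fun _ : Fin n => (Finset.univ : Finset X))
    (fun _ a => ∑ b, (μ a * W a b * Real.exp (f a b)))
  rw [Fintype.piFinset_univ] at h3
  rw [← h3, Finset.prod_const, Finset.card_univ, Fintype.card_fin]

theorem iidProb_nonneg {U : Type*} {n : ℕ} {μ : U → ℝ} (h : ∀ u, 0 ≤ μ u) (u : Fin n → U) :
    0 ≤ iidProb μ u := Finset.prod_nonneg fun _ _ => h _

theorem channelProb_nonneg {X Y : Type*} {n : ℕ} {W : X → Y → ℝ} (h : ∀ x y, 0 ≤ W x y)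
    (x : Fin n → X) (y : Fin n → Y) :
    0 ≤ channelProb W x y := Finset.prod_nonneg fun _ _ => h _ _

theorem sum_iidProb {n : ℕ} {μ : X → ℝ} (h : ∑ a, μ a = 1) : ∑ x : Fin n → X, iidProb μ x = 1 := by
  classical
  have h3 := Finset.prod_univ_sum (fun _ : Fin n => (Finset.univ : Finset X)) (fun _ a => μ a)
  rw [Fintype.piFinset_univ] at h3
  simp only [iidProb]
  rw [← h3, h]
  simp

theorem sum_channelProb {X : Type*} {n : ℕ} {W : X → Y → ℝ} (h : ∀ a, ∑ b, W a b = 1) (x : Fin n → X) :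
    ∑ y : Fin n → Y, channelProb W x y = 1 := by
  classical
  have h3 := Finset.prod_univ_sum (fun _ : Fin n => (Finset.univ : Finset Y))
    (fun i b => W (x i) b)
  rw [Fintype.piFinset_univ] at h3
  simp only [channelProb]
  rw [← h3]
  simp [h]

/-- The probability of an event under the joint law of `(Xⁿ, Yⁿ)`. -/
noncomputable def jointProb {n : ℕ} (μ : X → ℝ) (W : X → Y → ℝ) (P : (Fin n → X) → (Fin n → Y) → Prop) : ℝ :=
  open Classical in ∑ x, ∑ y, iidProb μ x * channelProb W x y * (if P x y then 1 else 0)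

variable {μ : X → ℝ} {W : X → Y → ℝ} {n : ℕ}

/-- Pairs of probability zero are exempt from the implication, so that logarithms of the letter
probabilities may be taken when it is applied. -/
theorem jointProb_mono (hμ : ∀ a, 0 ≤ μ a) (hW : ∀ a b, 0 ≤ W a b)
    {P Q : (Fin n → X) → (Fin n → Y) → Prop}
    (h : ∀ x y, 0 < iidProb μ x → 0 < channelProb W x y → P x y → Q x y) :
    jointProb μ W P ≤ jointProb μ W Q := by
  classical
  refine Finset.sum_le_sum fun x _ => Finset.sum_le_sum fun y _ => ?_
  rcases (iidProb_nonneg hμ x).eq_or_lt with hx | hx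
  · simp [← hx]
  rcases (channelProb_nonneg hW x y).eq_or_lt with hy | hy
  · simp [← hy]
  refine mul_le_mul_of_nonneg_left ?_ (by positivity)
  by_cases hP : P x y
  · simp [hP, h x y hx hy hP]
  · rw [if_neg hP]; positivity

theorem jointProb_or_le (hμ : ∀ a, 0 ≤ μ a) (hW : ∀ a b, 0 ≤ W a b)
    (P Q : (Fin n → X) → (Fin n → Y) → Prop) :
    jointProb μ W (fun x y => P x y ∨ Q x y) ≤ jointProb μ W P + jointProb μ W Q := by
  classical
  simp only [jointProb, ← Finset.sum_add_distrib, ← mul_add]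
  refine Finset.sum_le_sum fun x _ => Finset.sum_le_sum fun y _ =>
    mul_le_mul_of_nonneg_left ?_
      (mul_nonneg (iidProb_nonneg hμ x) (channelProb_nonneg hW x y))
  by_cases hP : P x y <;> by_cases hQ : Q x y <;> simp [hP, hQ]

/-- Chernoff's bound. -/
theorem jointProb_le_exp (hμ : ∀ a, 0 ≤ μ a) (hW : ∀ a b, 0 ≤ W a b) (f : X → Y → ℝ) {r t : ℝ}
    (hr : ∑ a, ∑ b, μ a * W a b * Real.exp (f a b) ≤ Real.exp r) :
    jointProb μ W (fun (x : Fin n → X) (y : Fin n → Y) => n * t ≤ ∑ i, f (x i) (y i))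
      ≤ Real.exp (n * (r - t)) := by
  classical
  have hpos : 0 ≤ ∑ a, ∑ b, μ a * W a b * Real.exp (f a b) :=
    Finset.sum_nonneg fun a _ => Finset.sum_nonneg fun b _ =>
      mul_nonneg (mul_nonneg (hμ a) (hW a b)) (Real.exp_pos _).le
  calc _ ≤ ∑ x : Fin n → X, ∑ y : Fin n → Y, iidProb μ x * channelProb W x y *
          Real.exp (∑ i, f (x i) (y i)) * Real.exp (-(n * t)) := by
        refine Finset.sum_le_sum fun x _ => Finset.sum_le_sum fun y _ => ?_
        rw [mul_assoc _ (Real.exp _), ← Real.exp_add]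
        refine mul_le_mul_of_nonneg_left ?_
          (mul_nonneg (iidProb_nonneg hμ x) (channelProb_nonneg hW x y))
        split_ifs with h
        · exact Real.one_le_exp (by linarith)
        · positivity
    _ = (∑ a, ∑ b, μ a * W a b * Real.exp (f a b)) ^ n * Real.exp (-(n * t)) := by
        rw [← sum_iidProb_mul_channelProb_mul_exp]
        simp_rw [Finset.sum_mul]
    _ ≤ Real.exp r ^ n * Real.exp (-(n * t)) := by gcongr
    _ = Real.exp (n * (r - t)) := by
        rw [← Real.exp_nat_mul, ← Real.exp_add]
        ring_nf

theorem sum_sum_eq_one (hμ : μ ∈ stdSimplex ℝ X) (hW : ∀ x, W x ∈ stdSimplex ℝ Y) :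
    ∑ a, ∑ b, μ a * W a b = 1 := by
  simp_rw [← Finset.mul_sum, (hW _).2, mul_one]
  exact hμ.2

theorem exp_le_one_add_add_sq {z : ℝ} (h : |z| ≤ 1) : Real.exp z ≤ 1 + z + z ^ 2 := by
  have := (abs_le.1 (Real.abs_exp_sub_one_sub_id_le h)).2
  linarith

/-- Chernoff's bound for bounded variables of mean zero. -/
theorem jointProb_le_exp_of_abs_le (hμ : μ ∈ stdSimplex ℝ X) (hW : ∀ x, W x ∈ stdSimplex ℝ Y)
    (f : X → Y → ℝ) {K l t : ℝ} (hl : 0 ≤ l) (hlK : l * K ≤ 1) (hf : ∀ a b, |f a b| ≤ K)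
    (hmean : ∑ a, ∑ b, μ a * W a b * f a b = 0) :
    jointProb μ W (fun (x : Fin n → X) (y : Fin n → Y) => n * t ≤ ∑ i, f (x i) (y i))
      ≤ Real.exp (n * ((l * K) ^ 2 - l * t)) := by
  have hW0 : ∀ a b, 0 ≤ W a b := fun a => (hW a).1
  have habs : ∀ a b, |l * f a b| ≤ l * K := fun a b => by
    rw [abs_mul, abs_of_nonneg hl]
    exact mul_le_mul_of_nonneg_left (hf a b) hl
  have hr : ∑ a, ∑ b, μ a * W a b * Real.exp (l * f a b) ≤ Real.exp ((l * K) ^ 2) := by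
    calc _ ≤ ∑ a, ∑ b, μ a * W a b * (1 + l * f a b + (l * K) ^ 2) := by
          refine Finset.sum_le_sum fun a _ => Finset.sum_le_sum fun b _ =>
            mul_le_mul_of_nonneg_left ?_ (mul_nonneg (hμ.1 a) (hW0 a b))
          have h1 := exp_le_one_add_add_sq ((habs a b).trans hlK)
          have h2 : (l * f a b) ^ 2 ≤ (l * K) ^ 2 := sq_le_sq' (abs_le.1 (habs a b)).1
            (abs_le.1 (habs a b)).2
          linarith
      _ = (1 + (l * K) ^ 2) * ∑ a, ∑ b, μ a * W a b + l * ∑ a, ∑ b, μ a * W a b * f a b := by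
          simp_rw [Finset.mul_sum, ← Finset.sum_add_distrib]
          exact Finset.sum_congr rfl fun a _ => Finset.sum_congr rfl fun b _ => by ring
      _ = (l * K) ^ 2 + 1 := by rw [sum_sum_eq_one hμ hW, hmean]; ring
      _ ≤ _ := Real.add_one_le_exp _
  refine (jointProb_mono hμ.1 hW0 fun x y _ _ h => ?_).trans
    (jointProb_le_exp hμ.1 hW0 (fun a b => l * f a b) (t := l * t) hr)
  rw [← Finset.mul_sum]
  nlinarith

/-- The weak law of large numbers, one-sided. -/
theorem tendsto_jointProb_zero (hμ : μ ∈ stdSimplex ℝ X) (hW : ∀ x, W x ∈ stdSimplex ℝ Y)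
    (f : X → Y → ℝ) {t : ℝ} (ht : 0 < t) (hmean : ∑ a, ∑ b, μ a * W a b * f a b = 0) :
    Tendsto (fun n : ℕ =>
      jointProb μ W (fun (x : Fin n → X) (y : Fin n → Y) => n * t ≤ ∑ i, f (x i) (y i)))
      atTop (𝓝 0) := by
  obtain ⟨K, hK⟩ : ∃ K : ℝ, ∀ z : X × Y, |f z.1 z.2| ≤ K := by
    obtain ⟨K, hK⟩ := (Set.finite_range fun z : X × Y => |f z.1 z.2|).bddAbove
    exact ⟨K, fun z => hK ⟨z, rfl⟩⟩
  -- Enlarging `K` to at least `t` keeps `l * K'`, which is `t / (2 K')`, below 1; this `l`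
  -- minimizes the exponent `(l K')² - l t`.
  set K' := max K t with hK'
  have hK'0 : 0 < K' := ht.trans_le (le_max_right _ _)
  set l := t / (2 * K' ^ 2) with hl
  have hl0 : 0 < l := by positivity
  have hlK : l * K' ≤ 1 := by
    rw [hl, div_mul_eq_mul_div, div_le_one (by positivity)]
    nlinarith [le_max_right K t]
  have hneg : (l * K') ^ 2 - l * t < 0 := by
    have : (l * K') ^ 2 - l * t = -(t ^ 2 / (4 * K' ^ 2)) := by
      rw [hl]; field_simp; ring
    rw [this]
    have : 0 < t ^ 2 / (4 * K' ^ 2) := by positivity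
    linarith
  refine squeeze_zero (fun n => ?_) (fun n => jointProb_le_exp_of_abs_le hμ hW f hl0.le hlK
    (fun a b => (hK (a, b)).trans (le_max_left _ _)) hmean) ?_
  · exact Finset.sum_nonneg fun x _ => Finset.sum_nonneg fun y _ =>
      mul_nonneg (mul_nonneg (iidProb_nonneg hμ.1 x) (channelProb_nonneg (fun a => (hW a).1) x y))
        (by positivity)
  · exact Real.tendsto_exp_atBot.comp
      (tendsto_natCast_atTop_atTop.atTop_mul_const_of_neg hneg)

end Chernoff

/-! ### The cumulant generating function of the self-information -/

section Tilting

variable {Y : Type*} [Fintype Y]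

/-- Hölder against the constant 1, with exponents `1 / (1 - w)` and `1 / w`. -/
theorem sum_rpow_one_sub_le {p : Y → ℝ} (hp : p ∈ stdSimplex ℝ Y) {w : ℝ} (hw0 : 0 ≤ w)
    (hw1 : w < 1) : ∑ y, p y ^ (1 - w) ≤ (Fintype.card Y : ℝ) ^ w := by
  rcases hw0.eq_or_lt with rfl | hw
  · simp [hp.2]
  have h := Real.inner_le_Lp_mul_Lq_of_nonneg (s := Finset.univ) (p := (1 - w)⁻¹) (q := w⁻¹)
    (f := fun y => p y ^ (1 - w)) (g := fun _ => 1)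
    (Real.holderConjugate_iff.2 ⟨(one_lt_inv₀ (by linarith)).2 (by linarith), by simp⟩)
    (fun y _ => Real.rpow_nonneg (hp.1 y) _) (fun _ _ => zero_le_one)
  have h2 : ∀ y, (p y ^ (1 - w)) ^ (1 - w)⁻¹ = p y := fun y => by
    rw [← Real.rpow_mul (hp.1 y), mul_inv_cancel₀ (by linarith), Real.rpow_one]
  simp_rw [h2, hp.2] at h
  simpa using h

/-- On `x ≥ 0` the maximum of `x² exp (-x)` is at `x = 2`. This absorbs the unbounded square of the
self-information into a small power of the probability. -/
theorem sq_mul_exp_neg_le {x : ℝ} (hx : 0 ≤ x) : x ^ 2 ≤ 4 * Real.exp (x - 2) := by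
  have h := Real.add_one_le_exp (x / 2 - 1)
  have h2 : Real.exp (x - 2) = Real.exp (x / 2 - 1) ^ 2 := by
    rw [← Real.exp_nat_mul]; congr 1; push_cast; ring
  rw [h2]
  nlinarith

/-- Divided by `exp z`, the claim is that `(1 + x) exp (-x) + x² / 2`, with derivative `x (1 - exp
(-x)) ≥ 0`, stays above its value 1 at 0. -/
theorem exp_le_one_add_add_sq_mul_exp {z : ℝ} (h : 0 ≤ z) :
    Real.exp z ≤ 1 + z + z ^ 2 / 2 * Real.exp z := by
  have hd : ∀ x : ℝ, HasDerivAt (fun x => (1 + x) * Real.exp (-x) + x ^ 2 / 2)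
      (x * (1 - Real.exp (-x))) x := by
    intro x
    have h1 := (((hasDerivAt_id x).const_add 1).mul (hasDerivAt_id x).neg.exp).add
      ((hasDerivAt_pow 2 x).div_const 2)
    refine h1.congr_deriv ?_
    simp
    ring
  have hm : MonotoneOn (fun x => (1 + x) * Real.exp (-x) + x ^ 2 / 2) (Set.Ici (0 : ℝ)) := by
    refine monotoneOn_of_deriv_nonneg (convex_Ici 0)
      (fun x _ => (hd x).continuousAt.continuousWithinAt)
      (fun x _ => (hd x).differentiableAt.differentiableWithinAt) fun x hx => ?_
    rw [interior_Ici] at hx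
    rw [(hd x).deriv]
    have : Real.exp (-x) ≤ 1 := Real.exp_le_one_iff.2 (by linarith [Set.mem_Ioi.1 hx])
    exact mul_nonneg (Set.mem_Ioi.1 hx).le (by linarith)
  have h2 := hm Set.self_mem_Ici (Set.mem_Ici.2 h) h
  have h3 : Real.exp (-z) * Real.exp z = 1 := by rw [← Real.exp_add]; simp
  simp only [neg_zero, Real.exp_zero, add_zero, mul_one, ne_eq, OfNat.ofNat_ne_zero,
    not_false_eq_true, zero_pow, zero_div] at h2
  nlinarith [Real.exp_pos z, mul_le_mul_of_nonneg_right h2 (Real.exp_pos z).le]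

/-- A quadratic bound on the cumulant generating function of the self-information. -/
theorem sum_mul_exp_neg_log_le {p : Y → ℝ} (hp : p ∈ stdSimplex ℝ Y)
    (hY : 2 ≤ Fintype.card Y) {s : ℝ} (hs0 : 0 ≤ s)
    (hs : s * Real.log (Fintype.card Y) ≤ 1 / 8) :
    ∑ y, p y * Real.exp (-(s * Real.log (p y)))
      ≤ 1 + s * ∑ y, Real.negMulLog (p y) + 4 * (s * Real.log (Fintype.card Y)) ^ 2 := by
  set L := Real.log (Fintype.card Y) with hL
  have hN : (2 : ℝ) ≤ Fintype.card Y := by exact_mod_cast hY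
  have hL0 : 0.69 < L := lt_of_lt_of_le (by linarith [Real.log_two_gt_d9])
    (Real.log_le_log (by norm_num) hN)
  -- Replacing `f²` by an exponential costs a factor `p ^ (-t)`. With `t L = 1 / 2` and `s L ≤ 1 /
  -- 8` the resulting power sum is at most `exp (5 / 8)`; since `exp (-2 + 5 / 8) ≤ 1 / 2`, the
  -- constant 8 becomes 4.
  set t := 1 / (2 * L) with ht
  have ht0 : 0 < t := by positivity
  have htL : t * L = 1 / 2 := by rw [ht]; field_simp
  have hst : s + t < 1 := by nlinarith
  have hpt : ∀ y, p y * Real.exp (-(s * Real.log (p y)))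
      ≤ p y + s * Real.negMulLog (p y)
        + 8 * (s * L) ^ 2 * Real.exp (-2) * p y ^ (1 - (s + t)) := by
    intro y
    rcases (hp.1 y).eq_or_lt with h0 | h0
    · rw [← h0]
      simp only [zero_mul, Real.negMulLog_zero, mul_zero, add_zero, zero_add]
      positivity
    have hle : p y ≤ 1 := by
      rw [← hp.2]
      exact Finset.single_le_sum (fun i _ => hp.1 i) (Finset.mem_univ y)
    set f := -Real.log (p y) with hf
    have hf0 : 0 ≤ f := by rw [hf]; linarith [Real.log_nonpos h0.le hle]
    have e1 := exp_le_one_add_add_sq_mul_exp (mul_nonneg hs0 hf0)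
    have e2 := sq_mul_exp_neg_le (mul_nonneg ht0.le hf0)
    have e3 : f ^ 2 ≤ 16 * L ^ 2 * Real.exp (t * f - 2) := by
      have : f ^ 2 = (2 * L) ^ 2 * (t * f) ^ 2 := by
        rw [mul_pow t, ← mul_assoc, ← mul_pow, show 2 * L * t = 1 by linarith, one_pow, one_mul]
      rw [this]
      nlinarith [sq_nonneg L]
    have e4 : p y * Real.exp (t * f - 2) * Real.exp (s * f)
        = Real.exp (-2) * p y ^ (1 - (s + t)) := by
      rw [Real.rpow_def_of_pos h0, ← Real.exp_add]
      nth_rewrite 1 [← Real.exp_log h0]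
      rw [← Real.exp_add, ← Real.exp_add]
      congr 1
      rw [hf]; ring
    have e5 : -(s * Real.log (p y)) = s * f := by rw [hf]; ring
    rw [e5]
    calc p y * Real.exp (s * f)
        ≤ p y * (1 + s * f + s ^ 2 * (16 * L ^ 2 * Real.exp (t * f - 2)) / 2 * Real.exp (s * f)) := by
          refine mul_le_mul_of_nonneg_left (e1.trans ?_) h0.le
          rw [mul_pow]
          gcongr
      _ = p y + s * Real.negMulLog (p y)
          + 8 * (s * L) ^ 2 * (p y * Real.exp (t * f - 2) * Real.exp (s * f)) := by
          rw [Real.negMulLog, hf]; ring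
      _ = _ := by rw [e4]; ring
  have hpow : (Fintype.card Y : ℝ) ^ (s + t) ≤ Real.exp (5 / 8) := by
    rw [Real.rpow_def_of_pos (by linarith)]
    refine Real.exp_le_exp.2 ?_
    rw [← hL]
    nlinarith
  have hexp : Real.exp (-2) * Real.exp (5 / 8) ≤ 1 / 2 := by
    rw [← Real.exp_add, show (-2 + 5 / 8 : ℝ) = -(11 / 8) by norm_num, Real.exp_neg,
      one_div]
    gcongr
    linarith [Real.add_one_le_exp (11 / 8 : ℝ)]
  calc _ ≤ ∑ y, (p y + s * Real.negMulLog (p y)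
        + 8 * (s * L) ^ 2 * Real.exp (-2) * p y ^ (1 - (s + t))) :=
        Finset.sum_le_sum fun y _ => hpt y
    _ = 1 + s * ∑ y, Real.negMulLog (p y)
        + 8 * (s * L) ^ 2 * Real.exp (-2) * ∑ y, p y ^ (1 - (s + t)) := by
        rw [Finset.sum_add_distrib, Finset.sum_add_distrib, ← Finset.mul_sum, ← Finset.mul_sum,
          hp.2]
    _ ≤ 1 + s * ∑ y, Real.negMulLog (p y) + 8 * (s * L) ^ 2 * Real.exp (-2) * Real.exp (5 / 8) := by
        gcongr
        exact (sum_rpow_one_sub_le hp (by positivity) hst).trans hpow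
    _ ≤ _ := by nlinarith [sq_nonneg (s * L)]

end Tilting

/-! ### Large deviations, likely sets and equipartition for the source -/

section Source

variable {X Y : Type*} [Fintype X] [Fintype Y] {μ : X → ℝ} {W : X → Y → ℝ} {ρ : X → Y → ℝ}

theorem outputDist_mem_stdSimplex (hμ : μ ∈ stdSimplex ℝ X) (hW : ∀ x, W x ∈ stdSimplex ℝ Y) :
    outputDist μ W ∈ stdSimplex ℝ Y := by
  refine ⟨fun y => Finset.sum_nonneg fun x _ => mul_nonneg (hμ.1 x) ((hW x).1 y), ?_⟩
  simp only [outputDist]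
  rw [Finset.sum_comm]
  exact sum_sum_eq_one hμ hW

theorem logb_two_one_div_mul_log_two (w : ℝ) :
    Real.logb 2 (1 / w) * Real.log 2 = -Real.log w := by
  rw [Real.logb, div_mul_cancel₀ _ (Real.log_pos one_lt_two).ne', one_div, Real.log_inv]

theorem entropy_mul_log_two {U : Type*} [Fintype U] (p : U → ℝ) :
    entropy p * Real.log 2 = ∑ y, Real.negMulLog (p y) := by
  rw [entropy, Finset.sum_mul]
  refine Finset.sum_congr rfl fun y _ => ?_
  rw [mul_assoc, logb_two_one_div_mul_log_two, Real.negMulLog]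
  ring

theorem condEntropy_mul_log_two (μ : X → ℝ) (W : X → Y → ℝ) :
    condEntropy μ W * Real.log 2 = ∑ x, ∑ y, μ x * W x y * -Real.log (W x y) := by
  simp_rw [condEntropy, Finset.sum_mul, mul_assoc, logb_two_one_div_mul_log_two]
  exact Finset.sum_congr rfl fun x _ => Finset.sum_congr rfl fun y _ => by ring

theorem log_channelProb {X Y : Type*} {W : X → Y → ℝ} {n : ℕ} {x : Fin n → X} {y : Fin n → Y} (h : 0 < channelProb W x y) :
    Real.log (channelProb W x y) = ∑ i, Real.log (W (x i) (y i)) :=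
  Real.log_prod fun i _ => Finset.prod_ne_zero_iff.1 h.ne' i (Finset.mem_univ i)

theorem le_rhoMax (ρ : X → Y → ℝ) (x : X) (y : Y) : ρ x y ≤ rhoMax ρ :=
  le_ciSup (f := fun z : X × Y => ρ z.1 z.2) (Set.finite_range _).bddAbove (x, y)

theorem rhoMax_nonneg {X Y : Type*} {ρ : X → Y → ℝ} (hρ : ∀ x y, 0 ≤ ρ x y) : 0 ≤ rhoMax ρ :=
  Real.iSup_nonneg fun z => hρ z.1 z.2

theorem expDist_nonneg (hμ : μ ∈ stdSimplex ℝ X) (hW : ∀ x, W x ∈ stdSimplex ℝ Y)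
    (hρ : ∀ x y, 0 ≤ ρ x y) : 0 ≤ expDist μ W ρ :=
  Finset.sum_nonneg fun x _ => Finset.sum_nonneg fun y _ =>
    mul_nonneg (mul_nonneg (hμ.1 x) ((hW x).1 y)) (hρ x y)

theorem expDist_le_rhoMax (hμ : μ ∈ stdSimplex ℝ X) (hW : ∀ x, W x ∈ stdSimplex ℝ Y) :
    expDist μ W ρ ≤ rhoMax ρ := by
  calc expDist μ W ρ ≤ ∑ x, ∑ y, μ x * W x y * rhoMax ρ :=
        Finset.sum_le_sum fun x _ => Finset.sum_le_sum fun y _ =>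
          mul_le_mul_of_nonneg_left (le_rhoMax ρ x y) (mul_nonneg (hμ.1 x) ((hW x).1 y))
    _ = rhoMax ρ := by simp_rw [← Finset.sum_mul]; rw [sum_sum_eq_one hμ hW, one_mul]

theorem sum_sum_mul_sub_const (hμ : μ ∈ stdSimplex ℝ X) (hW : ∀ x, W x ∈ stdSimplex ℝ Y)
    (f : X → Y → ℝ) (m : ℝ) :
    ∑ a, ∑ b, μ a * W a b * (f a b - m) = (∑ a, ∑ b, μ a * W a b * f a b) - m := by
  simp_rw [mul_sub, Finset.sum_sub_distrib, ← Finset.sum_mul]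
  rw [sum_sum_eq_one hμ hW, one_mul]

theorem blockDist_le {n : ℕ} (ρ : X → Y → ℝ) (x : Fin n → X) (y : Fin n → Y) :
    blockDist ρ x y ≤ n * rhoMax ρ := by
  calc blockDist ρ x y ≤ ∑ _i : Fin n, rhoMax ρ := Finset.sum_le_sum fun i _ => le_rhoMax ρ _ _
    _ = n * rhoMax ρ := by simp

/-- Large deviations of the distortion. -/
theorem jointProb_blockDist_le (hμ : μ ∈ stdSimplex ℝ X) (hW : ∀ x, W x ∈ stdSimplex ℝ Y)
    (hρ : ∀ x y, 0 ≤ ρ x y) (hR : 0 < rhoMax ρ) {ε : ℝ} (hε : 0 ≤ ε) (hε' : 2 * √ε ≤ 1) (n : ℕ) :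
    jointProb μ W (fun (x : Fin n → X) (y : Fin n → Y) =>
      n * (expDist μ W ρ + 4 * √ε * rhoMax ρ) ≤ blockDist ρ x y) ≤ Real.exp (n * (-(4 * ε))) := by
  -- With `l = 2 √ε / ρ_max` the Chernoff exponent is `4 ε - 8 ε = -4 ε`.
  have hl : 2 * √ε / rhoMax ρ * rhoMax ρ = 2 * √ε := div_mul_cancel₀ _ hR.ne'
  have h := jointProb_le_exp_of_abs_le (n := n) hμ hW (fun a b => ρ a b - expDist μ W ρ)
    (K := rhoMax ρ) (l := 2 * √ε / rhoMax ρ) (t := 4 * √ε * rhoMax ρ) (by positivity)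
    (by rwa [hl])
    (fun a b => abs_le.2 ⟨by linarith [hρ a b, expDist_le_rhoMax (ρ := ρ) hμ hW],
      by linarith [le_rhoMax ρ a b, expDist_nonneg hμ hW hρ]⟩)
    (by rw [sum_sum_mul_sub_const hμ hW]; exact sub_self _)
  have he : (2 * √ε / rhoMax ρ * rhoMax ρ) ^ 2 - 2 * √ε / rhoMax ρ * (4 * √ε * rhoMax ρ)
      = -(4 * ε) := by
    have : 2 * √ε / rhoMax ρ * (4 * √ε * rhoMax ρ) = 4 * √ε * (2 * √ε / rhoMax ρ * rhoMax ρ) := by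
      ring
    rw [this, hl]
    nlinarith [Real.sq_sqrt hε]
  rw [he] at h
  refine (jointProb_mono hμ.1 (fun a => (hW a).1) fun x y _ _ hxy => ?_).trans h
  rw [Finset.sum_sub_distrib, Finset.sum_const, Finset.card_univ, Fintype.card_fin, nsmul_eq_mul]
  simp only [blockDist] at hxy
  linarith

theorem outputDist_pos_of_pos {X Y : Type*} [Fintype X] {μ : X → ℝ} {W : X → Y → ℝ}
    (hμ : ∀ a, 0 ≤ μ a) (hW : ∀ a b, 0 ≤ W a b) {n : ℕ}
    {x : Fin n → X} {y : Fin n → Y} (hx : 0 < iidProb μ x) (hy : 0 < channelProb W x y)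
    (i : Fin n) : 0 < outputDist μ W (y i) := by
  have h1 : 0 < μ (x i) :=
    (hμ _).lt_of_ne' (Finset.prod_ne_zero_iff.1 hx.ne' i (Finset.mem_univ i))
  have h2 : 0 < W (x i) (y i) :=
    (hW _ _).lt_of_ne' (Finset.prod_ne_zero_iff.1 hy.ne' i (Finset.mem_univ i))
  exact (mul_pos h1 h2).trans_le (Finset.single_le_sum (f := fun a => μ a * W a (y i))
    (fun a _ => mul_nonneg (hμ a) (hW a _)) (Finset.mem_univ (x i)))

/-- Large deviations of the self-information of the output. -/
theorem jointProb_iidProb_outputDist_lt (hμ : μ ∈ stdSimplex ℝ X)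
    (hW : ∀ x, W x ∈ stdSimplex ℝ Y) (hY : 2 ≤ Fintype.card Y) {θ k : ℝ} (hθ0 : 0 ≤ θ)
    (hθ : θ ≤ 1 / 2) (hk : 2 * θ * Real.log (Fintype.card Y) ≤ k) (n : ℕ) :
    jointProb μ W (fun (_ : Fin n → X) (y : Fin n → Y) => iidProb (outputDist μ W) y
      < Real.exp (-(n * (entropy (outputDist μ W) * Real.log 2 + k))))
      ≤ Real.exp (n * (-(θ ^ 2 / 4))) := by
  set L := Real.log (Fintype.card Y) with hL
  have hL0 : 0 < L := Real.log_pos (by exact_mod_cast hY)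
  set q := outputDist μ W with hq
  have hqs : q ∈ stdSimplex ℝ Y := outputDist_mem_stdSimplex hμ hW
  set H := entropy q * Real.log 2 with hH
  -- With `s L = θ / 4` the quadratic term is `θ² / 4`, while the gain `s k` is at least `θ² / 2`;
  -- the condition `s L ≤ 1 / 8` is `θ ≤ 1 / 2`.
  set s := θ / (4 * L) with hs
  have hsL : s * L = θ / 4 := by rw [hs]; field_simp
  have hs0 : 0 ≤ s := by positivity
  have hsum : ∑ a, ∑ b, μ a * W a b * Real.exp (-(s * Real.log (q b)))
      ≤ Real.exp (s * H + θ ^ 2 / 4) := by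
    have h1 := sum_mul_exp_neg_log_le hqs hY hs0 (by rw [← hL, hsL]; linarith)
    rw [← hL, hsL, ← entropy_mul_log_two, ← hH] at h1
    rw [Finset.sum_comm]
    simp_rw [← Finset.sum_mul]
    calc _ ≤ 1 + s * H + 4 * (θ / 4) ^ 2 := h1
      _ = s * H + θ ^ 2 / 4 + 1 := by ring
      _ ≤ _ := Real.add_one_le_exp _
  refine (jointProb_mono hμ.1 (fun a => (hW a).1) fun x y hx hy h => ?_).trans
    ((jointProb_le_exp hμ.1 (fun a => (hW a).1) (fun _ b => -(s * Real.log (q b)))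
      (t := s * (H + k)) hsum).trans ?_)
  · have hpos : ∀ i, 0 < q (y i) := outputDist_pos_of_pos hμ.1 (fun a => (hW a).1) hx hy
    have h2 := Real.log_le_log (Finset.prod_pos fun i _ => hpos i) h.le
    rw [Real.log_exp, Real.log_prod fun i _ => (hpos i).ne'] at h2
    rw [Finset.sum_neg_distrib, ← Finset.mul_sum]
    nlinarith
  · refine Real.exp_le_exp.2 (mul_le_mul_of_nonneg_left ?_ (Nat.cast_nonneg n))
    have : s * (2 * θ * L) ≤ s * k := mul_le_mul_of_nonneg_left hk hs0
    have h3 : s * (2 * θ * L) = θ ^ 2 / 2 := by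
      rw [show s * (2 * θ * L) = 2 * θ * (s * L) by ring, hsL]; ring
    linarith

/-- The output sequences whose conditional probability given `x` is about `exp (-n h)`. -/
noncomputable def typicalOutputs {n : ℕ} (W : X → Y → ℝ) (h τ : ℝ) (x : Fin n → X) :
    Finset (Fin n → Y) :=
  open Classical in Finset.univ.filter fun y =>
    Real.exp (-(n * (h + τ))) ≤ channelProb W x y ∧ channelProb W x y ≤ Real.exp (-(n * (h - τ)))

/-- The output sequences with property `P` whose conditional probability given `x` is at least
`exp (-n k)`. -/
noncomputable def likelyOutputsWith {n : ℕ} (W : X → Y → ℝ) (k : ℝ)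
    (P : (Fin n → X) → (Fin n → Y) → Prop) (x : Fin n → X) : Finset (Fin n → Y) :=
  open Classical in Finset.univ.filter fun y => Real.exp (-(n * k)) ≤ channelProb W x y ∧ P x y

/-- The sequences of probability at least `exp (-n k)`. -/
noncomputable def likelySet (n : ℕ) (q : Y → ℝ) (k : ℝ) : Finset (Fin n → Y) :=
  open Classical in Finset.univ.filter fun y => Real.exp (-(n * k)) ≤ iidProb q y

theorem card_likelySet_le (n : ℕ) {q : Y → ℝ} (hq : q ∈ stdSimplex ℝ Y) (k : ℝ) :
    ((likelySet n q k).card : ℝ) ≤ Real.exp (n * k) := by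
  classical
  have h : (likelySet n q k).card * Real.exp (-(n * k)) ≤ 1 := by
    rw [← nsmul_eq_mul, ← Finset.sum_const, ← sum_iidProb (n := n) hq.2]
    refine (Finset.sum_le_sum fun y hy => (Finset.mem_filter.1 hy).2).trans ?_
    exact Finset.sum_le_sum_of_subset_of_nonneg (Finset.subset_univ _)
      fun y _ _ => iidProb_nonneg hq.1 y
  rwa [Real.exp_neg, ← div_eq_mul_inv, div_le_one (Real.exp_pos _)] at h

/-- Change of measure: each counted sequence contributes 1, which is at most `exp (n k)` times its
conditional probability. An expected count thus becomes a probability of a rare event. -/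
theorem sum_mul_card_likelyOutputsWith_le {n : ℕ} (hμ : ∀ a, 0 ≤ μ a) (hW : ∀ a b, 0 ≤ W a b)
    (k : ℝ) (P : (Fin n → X) → (Fin n → Y) → Prop) :
    ∑ x, iidProb μ x * (likelyOutputsWith W k P x).card ≤ Real.exp (n * k) * jointProb μ W P := by
  classical
  rw [jointProb, Finset.mul_sum]
  refine Finset.sum_le_sum fun x _ => ?_
  simp_rw [mul_assoc (iidProb μ x), ← Finset.mul_sum]
  rw [mul_left_comm]
  refine mul_le_mul_of_nonneg_left ?_ (iidProb_nonneg hμ x)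
  rw [Finset.card_eq_sum_ones, Nat.cast_sum, likelyOutputsWith, Finset.sum_filter,
    Finset.mul_sum]
  refine Finset.sum_le_sum fun y _ => ?_
  split_ifs with h1 h2 h2
  · have := mul_le_mul_of_nonneg_left h1.1 (Real.exp_pos (n * k)).le
    rw [← Real.exp_add, add_neg_cancel, Real.exp_zero] at this
    simpa using this
  · exact absurd h1.2 h2
  · have := channelProb_nonneg hW x y
    positivity
  · simp

/-- A typical set this small carries conditional mass at most 1/2, its points having probability at
most `exp (-n (h - τ))`; the atypical outputs then carry at least 1/2, and Markov's inequality
applies. -/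
theorem sum_iidProb_typicalOutputs_small_le {n : ℕ} (hμ : μ ∈ stdSimplex ℝ X)
    (hW : ∀ x, W x ∈ stdSimplex ℝ Y) (h τ : ℝ) :
    ∑ x : Fin n → X with ((typicalOutputs W h τ x).card : ℝ) < Real.exp (n * (h - τ)) / 2,
      iidProb μ x ≤ 2 * jointProb μ W (fun (x : Fin n → X) y => y ∉ typicalOutputs W h τ x) := by
  classical
  rw [jointProb, Finset.mul_sum, Finset.sum_filter]
  refine Finset.sum_le_sum fun x _ => ?_
  have hp := iidProb_nonneg hμ.1 x
  simp_rw [mul_assoc (iidProb μ x), ← Finset.mul_sum]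
  have hnn : ∀ y, 0 ≤ channelProb W x y := channelProb_nonneg (fun a => (hW a).1) x
  refine (?_ : _ ≤ 2 * (iidProb μ x * ∑ y, channelProb W x y *
    (if y ∉ typicalOutputs W h τ x then (1 : ℝ) else 0))).trans_eq (by congr!)
  split_ifs with hx
  · have h1 : ∑ y ∈ typicalOutputs W h τ x, channelProb W x y ≤ 1 / 2 := by
      calc _ ≤ ∑ y ∈ typicalOutputs W h τ x, Real.exp (-(n * (h - τ))) :=
            Finset.sum_le_sum fun y hy => (Finset.mem_filter.1 hy).2.2
        _ = (typicalOutputs W h τ x).card * Real.exp (-(n * (h - τ))) := by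
            rw [Finset.sum_const, nsmul_eq_mul]
        _ ≤ Real.exp (n * (h - τ)) / 2 * Real.exp (-(n * (h - τ))) := by gcongr
        _ = 1 / 2 := by
            rw [div_mul_eq_mul_div, ← Real.exp_add, add_neg_cancel, Real.exp_zero]
    have h2 : ∑ y, channelProb W x y * (if y ∉ typicalOutputs W h τ x then (1 : ℝ) else 0)
        = 1 - ∑ y ∈ typicalOutputs W h τ x, channelProb W x y := by
      rw [eq_sub_iff_add_eq, ← Fintype.sum_ite_mem (typicalOutputs W h τ x),
        ← Finset.sum_add_distrib]
      refine (Finset.sum_congr rfl fun y _ => ?_).trans (sum_channelProb (fun a => (hW a).2) x)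
      split_ifs <;> simp
    rw [h2]
    nlinarith
  · have : 0 ≤ ∑ y, channelProb W x y * (if y ∉ typicalOutputs W h τ x then (1 : ℝ) else 0) :=
      Finset.sum_nonneg fun y _ => mul_nonneg (hnn y) (by positivity)
    positivity

/-- The asymptotic equipartition property. -/
theorem tendsto_jointProb_notMem_typicalOutputs (hμ : μ ∈ stdSimplex ℝ X)
    (hW : ∀ x, W x ∈ stdSimplex ℝ Y) {τ : ℝ} (hτ : 0 < τ) :
    Tendsto (fun n : ℕ => jointProb μ W (fun (x : Fin n → X) (y : Fin n → Y) =>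
      y ∉ typicalOutputs W (condEntropy μ W * Real.log 2) τ x)) atTop (𝓝 0) := by
  set h := condEntropy μ W * Real.log 2 with hh
  have m1 : ∑ a, ∑ b, μ a * W a b * (-Real.log (W a b) - h) = 0 := by
    rw [sum_sum_mul_sub_const hμ hW, hh, condEntropy_mul_log_two, sub_self]
  have m2 : ∑ a, ∑ b, μ a * W a b * (-(-Real.log (W a b) - h)) = 0 := by
    simp_rw [mul_neg _ (_ - h), Finset.sum_neg_distrib, m1, neg_zero]
  have t := (tendsto_jointProb_zero hμ hW _ hτ m1).add (tendsto_jointProb_zero hμ hW _ hτ m2)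
  rw [add_zero] at t
  have hW0 : ∀ a b, 0 ≤ W a b := fun a => (hW a).1
  refine squeeze_zero (fun n => ?_) (fun n => ?_) t
  · exact Finset.sum_nonneg fun x _ => Finset.sum_nonneg fun y _ =>
      mul_nonneg (mul_nonneg (iidProb_nonneg hμ.1 x) (channelProb_nonneg hW0 x y))
        (by positivity)
  · refine (jointProb_mono hμ.1 hW0 fun x y hx hy hxy => ?_).trans
      (jointProb_or_le hμ.1 hW0 _ _)
    rw [Finset.sum_neg_distrib, Finset.sum_sub_distrib, Finset.sum_neg_distrib,
      ← log_channelProb hy, Finset.sum_const, Finset.card_univ, Fintype.card_fin, nsmul_eq_mul]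
    by_contra! hc
    refine hxy (Finset.mem_filter.2 ⟨Finset.mem_univ _, ?_, ?_⟩)
    · rw [← Real.le_log_iff_exp_le hy]
      linarith [hc.1]
    · rw [← Real.log_le_iff_le_exp hy]
      linarith [hc.2]

end Source

/-! ### Block lengths, rates and image sizes -/

section Lengths

variable {Y : Type*} [Fintype Y] {l : ℕ → ℕ} {r : ℝ}

/-- The strict bound at `n = 1` forces `log |Y| > 0`; for an empty alphabet `Real.logb 2 0 = 0`
gives the contradiction. -/
theorem IsBlockLength.two_le_card (hl : IsBlockLength Y l r) : 2 ≤ Fintype.card Y := by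
  have h := (abs_nonneg _).trans_lt (hl 1 le_rfl)
  by_contra! hc
  interval_cases Fintype.card Y <;> simp at h

theorem IsBlockLength.abs_sub_lt (hl : IsBlockLength Y l r) {n : ℕ} (hn : 1 ≤ n) :
    |(l n : ℝ) * Real.log (Fintype.card Y) - n * (r * Real.log 2)| <
      Real.log (Fintype.card Y) := by
  have h2 : 0 < Real.log 2 := Real.log_pos one_lt_two
  have h := mul_lt_mul_of_pos_right (hl n hn) h2
  rw [← abs_of_pos h2, ← abs_mul, abs_of_pos h2] at h
  have e : Real.logb 2 (Fintype.card Y) * Real.log 2 = Real.log (Fintype.card Y) :=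
    div_mul_cancel₀ _ h2.ne'
  rw [sub_mul, mul_assoc, e, mul_assoc] at h
  exact h

theorem abs_codeRate_sub_lt (hl : IsBlockLength Y l r) {n : ℕ} (hn : 1 ≤ n) :
    |codeRate Y n (l n) - r| < Real.logb 2 (Fintype.card Y) / n := by
  have hn0 : (0 : ℝ) < n := by exact_mod_cast hn
  have e : codeRate Y n (l n) - r = ((l n : ℝ) * Real.logb 2 (Fintype.card Y) - n * r) / n := by
    rw [codeRate]; field_simp
  rw [e, abs_div, abs_of_pos hn0]
  exact div_lt_div_of_pos_right (hl n hn) hn0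

theorem codeRate_eq (hl : IsBlockLength Y l r) {n : ℕ} (hn : 1 ≤ n) {k : ℕ}
    (hk : (k : ℝ) * Real.logb 2 (Fintype.card Y) = n * r) : codeRate Y n (l n) = r := by
  have hn0 : (0 : ℝ) < n := by exact_mod_cast hn
  have h := hl n hn
  have hpos := (abs_nonneg _).trans_lt h
  rw [← hk, ← sub_mul, abs_mul, abs_of_pos hpos] at h
  have h1 : |((l n : ℤ) - (k : ℤ) : ℤ)| < 1 := by
    have : |(l n : ℝ) - k| < 1 := by
      by_contra! hc
      linarith [le_mul_of_one_le_left hpos.le hc]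
    exact_mod_cast this
  have h2 : l n = k := by
    have := Int.abs_lt_one_iff.1 h1
    omega
  rw [codeRate, h2, hk]
  field_simp

/-- `|Im 𝒜| ≤ |𝒴| ^ l`. -/
theorem card_imFinset_le (hl : IsBlockLength Y l r) {n : ℕ} (hn : 1 ≤ n)
    (E : Ensemble (Fin n → Y) (Fin (l n) → Y)) :
    (E.imFinset.card : ℝ) ≤
      Real.exp (n * (r * Real.log 2) + Real.log (Fintype.card Y)) := by
  have hN : (0 : ℝ) < Fintype.card Y := by exact_mod_cast (by have := hl.two_le_card; omega)
  have h1 : (E.imFinset.card : ℝ) ≤ (Fintype.card Y : ℝ) ^ l n := by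
    have := Finset.card_le_univ E.imFinset
    rw [Fintype.card_fun, Fintype.card_fin] at this
    exact_mod_cast this
  refine h1.trans ?_
  rw [← Real.exp_log hN, ← Real.exp_nat_mul, Real.exp_log hN]
  exact Real.exp_le_exp.2 (by linarith [(abs_lt.1 (hl.abs_sub_lt hn)).2])

/-- The first clause of the hash property makes the image a fraction `exp (-o(n))` of `|Y| ^ l`; the
extra `log |Y|` pays for rounding `l`. -/
theorem eventually_le_card_imFinset (hl : IsBlockLength Y l r)
    (E : ∀ n, Ensemble (Fin n → Y) (Fin (l n) → Y)) {α β : ℕ → ℝ} (hE : HasHashProperty E α β)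
    {η : ℝ} (hη : 0 < η) :
    ∀ᶠ n : ℕ in atTop,
      Real.exp (n * (r * Real.log 2 - η) - Real.log (Fintype.card Y)) ≤ (E n).imFinset.card := by
  have hN : (0 : ℝ) < Fintype.card Y := by exact_mod_cast (by have := hl.two_le_card; omega)
  have : Nonempty Y := Fintype.card_pos_iff.1 (by exact_mod_cast hN)
  have h2 : 0 < Real.log 2 := Real.log_pos one_lt_two
  filter_upwards [hE.1.eventually_lt_const (div_pos hη h2), eventually_ge_atTop 1] with n hn hn1
  have hn0 : (0 : ℝ) < n := by exact_mod_cast hn1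
  have hm : (0 : ℝ) < (E n).imFinset.card := by exact_mod_cast (E n).imFinset_card_pos
  rw [(E n).ncard_im, Fintype.card_fun, Fintype.card_fin, Nat.cast_pow, Real.logb,
    Real.log_div (by positivity) hm.ne', Real.log_pow, div_lt_iff₀ hn0, div_lt_iff₀ h2] at hn
  have e : η / Real.log 2 * n * Real.log 2 = n * η := by field_simp
  rw [← Real.le_log_iff_exp_le hm]
  rw [e] at hn
  linarith [(abs_lt.1 (hl.abs_sub_lt hn1)).1]

end Lengths

/-! ### The two instances of the hash inequality -/

section Hash

variable {U : Type*} {R : ℕ → Type*} [∀ n, Fintype (R n)] {E : ∀ n, Ensemble (Fin n → U) (R n)}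
  {α β : ℕ → ℝ}

theorem HasHashProperty.sum_self_le (h : HasHashProperty E α β) {n : ℕ} (hn : 1 ≤ n)
    (T : Finset (Fin n → U)) : ∑ u ∈ T, ∑ u' ∈ T, (E n).collisionProb u u' ≤
      T.card + (T.card : ℝ) * T.card * α n / (E n).imFinset.card + T.card * β n := by
  classical
  have := h.2.2.2 n hn T T
  rwa [Finset.inter_self, min_self, (E n).ncard_im] at this

/-- The hash inequality for a singleton disjoint from `S`, so that the intersection term vanishes.
Absolute values appear because `α n` and `β n` may be negative for small `n`. -/
theorem HasHashProperty.sum_le (h : HasHashProperty E α β) {n : ℕ} (hn : 1 ≤ n)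
    (u : Fin n → U) (S : Finset (Fin n → U)) (hu : u ∉ S) :
    ∑ u' ∈ S, (E n).collisionProb u u' ≤
      S.card * |α n| / (E n).imFinset.card + |β n| := by
  classical
  have := h.2.2.2 n hn {u} S
  rw [Finset.sum_singleton, Finset.singleton_inter_of_notMem hu, (E n).ncard_im] at this
  simp only [Finset.card_empty, Finset.card_singleton, Nat.cast_zero, Nat.cast_one, zero_add,
    one_mul] at this
  refine this.trans (add_le_add ?_ ?_)
  · gcongr
    exact le_abs_self _
  · calc min 1 (S.card : ℝ) * β n ≤ min 1 (S.card : ℝ) * |β n| :=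
          mul_le_mul_of_nonneg_left (le_abs_self _) (by positivity)
      _ ≤ 1 * |β n| := by gcongr; exact min_le_left _ _
      _ = |β n| := one_mul _

end Hash

/-! ### Decoding, comparison of exponents, and the coding theorem -/

section Coding

variable {X Y : Type*} [Fintype X] [Fintype Y] {μ : X → ℝ} {W : X → Y → ℝ} {ρ : X → Y → ℝ}

theorem codeDistortion_le_rhoMax (hμ : μ ∈ stdSimplex ℝ X) {M : Type*} {n : ℕ} (hn : 1 ≤ n)
    (φ : (Fin n → X) → M) (ψ : M → (Fin n → Y)) : codeDistortion μ ρ φ ψ ≤ rhoMax ρ := by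
  have hn0 : (0 : ℝ) < n := by exact_mod_cast hn
  rw [codeDistortion, div_le_iff₀ hn0]
  calc _ ≤ ∑ x : Fin n → X, iidProb μ x * (n * rhoMax ρ) :=
        Finset.sum_le_sum fun x _ =>
          mul_le_mul_of_nonneg_left (blockDist_le ρ x _) (iidProb_nonneg hμ.1 x)
    _ = _ := by rw [← Finset.sum_mul, sum_iidProb hμ.2]; ring

/-- The output sequences whose distortion is at least `n d` or whose output probability is less than
`exp (-n k)`. -/
def IsBadPair (q : Y → ℝ) (ρ : X → Y → ℝ) (d k : ℝ) {n : ℕ} (x : Fin n → X) (y : Fin n → Y) :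
    Prop :=
  n * d ≤ blockDist ρ x y ∨ iidProb q y < Real.exp (-(n * k))

open Classical in
/-- Outside the error event, the decoder recovers the point chosen by the encoder. -/
theorem codeDistortion_le_add (hμ : μ ∈ stdSimplex ℝ X) (hρ : ∀ x y, 0 ≤ ρ x y) {q : Y → ℝ}
    {C M : Type*} {n : ℕ} (hn : 1 ≤ n) {gA : ((Fin n → Y) → C) → C → (Fin n → X) → (Fin n → Y)}
    {gAB : ((Fin n → Y) → C) → ((Fin n → Y) → M) → C → M → (Fin n → Y)}
    (hgA : IsEncoderArgmax W gA) (hgAB : IsDecoderArgmax q gAB) {h τ d k : ℝ} (hd : 0 ≤ d)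
    (A : (Fin n → Y) → C) (B : (Fin n → Y) → M) (c : C) :
    codeDistortion μ ρ (fun x => B (gA A c x)) (fun b => gAB A B c b) ≤
      d + rhoMax ρ * ∑ x, iidProb μ x * (if CodingError (typicalOutputs W h τ)
        (likelyOutputsWith W (h + τ) (IsBadPair q ρ d k)) (likelySet n q k) gA A B c x
        then 1 else 0) := by
  have hn0 : (0 : ℝ) < n := by exact_mod_cast hn
  have hR := rhoMax_nonneg hρ
  have hx : ∀ x : Fin n → X, blockDist ρ x (gAB A B c (B (gA A c x))) ≤
      n * d + n * rhoMax ρ * (if CodingError (typicalOutputs W h τ)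
        (likelyOutputsWith W (h + τ) (IsBadPair q ρ d k)) (likelySet n q k) gA A B c x
        then 1 else 0) := by
    intro x
    split_ifs with herr
    · have := blockDist_le ρ x (gAB A B c (B (gA A c x)))
      nlinarith
    · simp only [CodingError, not_or] at herr
      obtain ⟨h1, h2, h3⟩ := herr
      push Not at h1 h2 h3
      obtain ⟨y, hy, hyc⟩ := h1
      obtain ⟨e1, e2⟩ := hgA A c x ⟨y, hyc⟩
      -- The maximizer inherits only the lower bound from the typical point `y` of the fibre; it may
      -- itself be atypical.
      have hlik : Real.exp (-(n * (h + τ))) ≤ channelProb W x (gA A c x) :=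
        (Finset.mem_filter.1 hy).2.1.trans (e2 y hyc)
      have hbad : ¬ IsBadPair q ρ d k x (gA A c x) := fun hb =>
        h2 _ (Finset.mem_filter.2 ⟨Finset.mem_univ _, hlik, hb⟩) e1
      simp only [IsBadPair, not_or, not_le, not_lt] at hbad
      obtain ⟨⟨d1, d2⟩, d3⟩ := hgAB A B c (B (gA A c x)) ⟨gA A c x, e1, rfl⟩
      -- The decoder's point is at least as probable as the encoder's, hence in the likely set, and
      -- has the same two hash values; a difference would be a collision.
      have heq : gAB A B c (B (gA A c x)) = gA A c x := by
        by_contra hne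
        exact h3 _ (Finset.mem_filter.2 ⟨Finset.mem_univ _, hbad.2.trans (d3 _ e1 rfl)⟩) hne d1 d2
      rw [heq]
      linarith [hbad.1]
  rw [codeDistortion, div_le_iff₀ hn0]
  calc _ ≤ ∑ x : Fin n → X, iidProb μ x * (n * d + n * rhoMax ρ * (if CodingError
        (typicalOutputs W h τ) (likelyOutputsWith W (h + τ) (IsBadPair q ρ d k))
        (likelySet n q k) gA A B c x then 1 else 0)) :=
        Finset.sum_le_sum fun x _ => mul_le_mul_of_nonneg_left (hx x) (iidProb_nonneg hμ.1 x)
    _ = _ := by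
        simp_rw [mul_add, Finset.sum_add_distrib]
        rw [← Finset.sum_mul, sum_iidProb hμ.2, add_mul, one_mul, Finset.mul_sum, Finset.sum_mul]
        congr 1
        · ring
        · exact Finset.sum_congr rfl fun x _ => by ring

theorem tendsto_exp_natCast_mul_zero {c : ℝ} (hc : c < 0) :
    Tendsto (fun n : ℕ => Real.exp (n * c)) atTop (𝓝 0) :=
  Real.tendsto_exp_atBot.comp (tendsto_natCast_atTop_atTop.atTop_mul_const_of_neg hc)

open Classical in
/-- The error probability of the best code in the ensembles vanishes. -/
theorem eventually_exists_error_le (hμ : μ ∈ stdSimplex ℝ X) (hW : ∀ x, W x ∈ stdSimplex ℝ Y)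
    (hρ : ∀ x y, 0 ≤ ρ x y) (hR : 0 < rhoMax ρ) {εA εB θ k : ℝ} (hεA : 0 < εA)
    (hεA' : 2 * √εA ≤ 1) (hθ0 : 0 ≤ θ) (hθ : θ ≤ 1 / 2) (hθε : θ ^ 2 = 6 * εA)
    (hk : 2 * θ * Real.log (Fintype.card Y) ≤ k)
    (hgap : εA * Real.log 2 + k < εB * Real.log 2)
    {lA lB : ℕ → ℕ} (hlA : IsBlockLength Y lA (condEntropy μ W - εA))
    (hlB : IsBlockLength Y lB (mutualInfo μ W + εB))
    (𝒜 : ∀ n, Ensemble (Fin n → Y) (Fin (lA n) → Y))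
    (ℬ : ∀ n, Ensemble (Fin n → Y) (Fin (lB n) → Y))
    {α β α' β' : ℕ → ℝ} (hA : HasHashProperty 𝒜 α β) (hB : HasHashProperty ℬ α' β')
    {δ : ℝ} (hδ : 0 < δ) :
    ∃ h τ k', ∀ᶠ n : ℕ in atTop, ∀ gA : ((Fin n → Y) → (Fin (lA n) → Y)) → (Fin (lA n) → Y) →
        (Fin n → X) → (Fin n → Y),
      ∃ A ∈ (𝒜 n).carrier, ∃ B ∈ (ℬ n).carrier, ∃ c ∈ (𝒜 n).im,
        ∑ x, iidProb μ x * (if CodingError (typicalOutputs W h τ)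
          (likelyOutputsWith W (h + τ) (IsBadPair (outputDist μ W) ρ
            (expDist μ W ρ + 4 * √εA * rhoMax ρ) k'))
          (likelySet n (outputDist μ W) k') gA A B c x then 1 else 0) ≤ δ := by
  have hY := hlA.two_le_card
  have : Nonempty Y := Fintype.card_pos_iff.1 (by omega)
  have hW0 : ∀ a b, 0 ≤ W a b := fun a => (hW a).1
  have hln : 0.69 < Real.log 2 := by linarith [Real.log_two_gt_d9]
  have hln' : Real.log 2 < 0.7 := by linarith [Real.log_two_lt_d9]
  set L := Real.log (Fintype.card Y) with hL
  set h := condEntropy μ W * Real.log 2 with hh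
  set hY' := entropy (outputDist μ W) * Real.log 2 with hhY
  set e := εA * Real.log 2 with he
  set e' := εB * Real.log 2 with he'
  have he1 : 0.69 * εA < e := by rw [he]; nlinarith
  have he2 : e < 0.7 * εA := by rw [he]; nlinarith
  -- Slack for the three exponents: `τ < 0.69 εA < e`; `τ + e + η < (0.25 + 0.7 + 0.25) εA < 1.5
  -- εA`; and `2 η` is at most half the gap `e' - e - k`.
  set τ := εA / 4 with hτ
  have hτ0 : 0 < τ := by positivity
  set η := min (εA / 4) ((e' - e - k) / 4) with hη
  have hη0 : 0 < η := lt_min (by positivity) (by linarith)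
  have hη1 : η ≤ εA / 4 := min_le_left _ _
  have hη2 : η ≤ (e' - e - k) / 4 := min_le_right _ _
  refine ⟨h, τ, hY' + k, ?_⟩
  have rA : (condEntropy μ W - εA) * Real.log 2 = h - e := by rw [sub_mul]
  have rB : (mutualInfo μ W + εB) * Real.log 2 = hY' - h + e' := by
    rw [mutualInfo, add_mul, sub_mul]
  let J : ℕ → ℝ := fun n => jointProb μ W (fun (x : Fin n → X) (y : Fin n → Y) =>
      y ∉ typicalOutputs W h τ x)
  have hlim : Tendsto (fun n : ℕ => 2 * J n + |α n - 1|
      + 2 * Real.exp L * (1 + |β n|) * Real.exp (n * (τ - e))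
      + 2 * Real.exp L * Real.exp (n * (τ + e + η - 1.5 * εA))
      + (Real.exp (2 * L) * |α' n| * Real.exp (n * (k + e - e' + 2 * η)) + |β' n|))
      atTop (𝓝 0) := by
    have l1 : Tendsto J atTop (𝓝 0) := tendsto_jointProb_notMem_typicalOutputs hμ hW hτ0
    have l2 : Tendsto (fun n => |α n - 1|) atTop (𝓝 0) := by
      simpa using (hA.2.1.sub_const 1).abs
    have l3 : Tendsto (fun n => 2 * Real.exp L * (1 + |β n|)) atTop (𝓝 (2 * Real.exp L)) := by
      simpa using (hA.2.2.1.abs.const_add 1).const_mul (2 * Real.exp L)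
    have l4 : Tendsto (fun n => Real.exp (2 * L) * |α' n|) atTop (𝓝 (Real.exp (2 * L))) := by
      simpa using hB.2.1.abs.const_mul (Real.exp (2 * L))
    have l5 : Tendsto (fun n => |β' n|) atTop (𝓝 0) := by simpa using hB.2.2.1.abs
    have := ((((l1.const_mul 2).add l2).add
      (l3.mul (tendsto_exp_natCast_mul_zero (show τ - e < 0 by linarith)))).add
      ((tendsto_exp_natCast_mul_zero (show τ + e + η - 1.5 * εA < 0 by linarith)).const_mul
        (2 * Real.exp L))).add
      ((l4.mul (tendsto_exp_natCast_mul_zero (show k + e - e' + 2 * η < 0 by linarith))).add l5)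
    simpa using this
  filter_upwards [hlim.eventually_lt_const hδ, eventually_ge_atTop 1,
    eventually_le_card_imFinset hlA 𝒜 hA hη0, eventually_le_card_imFinset hlB ℬ hB hη0]
    with n hn hn1 hmA hmB gA
  have hmA' := card_imFinset_le hlA hn1 (𝒜 n)
  rw [rA, ← hL] at hmA hmA'
  rw [rB, ← hL] at hmB
  obtain ⟨A, hAm, B, hBm, c, hc, hle⟩ := exists_sum_codingError_le (iidProb μ)
    (iidProb_nonneg hμ.1) (sum_iidProb hμ.2) (𝒜 n) (ℬ n) (hA.sum_self_le hn1) (hB.sum_le hn1) gA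
    (typicalOutputs W h τ) (likelyOutputsWith W (h + τ) (IsBadPair (outputDist μ W) ρ
      (expDist μ W ρ + 4 * √εA * rhoMax ρ) (hY' + k)))
    (likelySet n (outputDist μ W) (hY' + k)) (t := Real.exp (n * (h - τ)) / 2) (by positivity)
  refine ⟨A, hAm, B, hBm, c, hc, hle.trans (le_trans ?_ hn.le)⟩
  have hmA0 : (0 : ℝ) < (𝒜 n).imFinset.card := (Real.exp_pos _).trans_le hmA
  have hmB0 : (0 : ℝ) < (ℬ n).imFinset.card := (Real.exp_pos _).trans_le hmB
  have hn0 : (0 : ℝ) ≤ n := Nat.cast_nonneg n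
  gcongr ?_ + _ + ?_ + ?_ + (?_ + _)
  · exact sum_iidProb_typicalOutputs_small_le hμ hW h τ
  · rw [div_le_iff₀ (by positivity)]
    calc _ ≤ Real.exp (n * (h - e) + L) * (1 + |β n|) := by gcongr
      _ = _ := by
        have : Real.exp (n * (h - e) + L)
            = Real.exp L * Real.exp (n * (τ - e)) * Real.exp (n * (h - τ)) := by
          rw [← Real.exp_add, ← Real.exp_add]; ring_nf
        rw [this]; ring
  · rw [div_le_iff₀ hmA0]
    -- The distortion deviates with exponent `4 εA`, the self-information with exponent `θ² / 4 =
    -- 1.5 εA`; the slower one governs.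
    have hbad : jointProb μ W (IsBadPair (n := n) (outputDist μ W) ρ
        (expDist μ W ρ + 4 * √εA * rhoMax ρ) (hY' + k)) ≤ 2 * Real.exp (n * (-(1.5 * εA))) := by
      refine (jointProb_or_le hμ.1 hW0 _ _).trans ?_
      have b1 := jointProb_blockDist_le hμ hW hρ hR hεA.le hεA' n
      have b2 := jointProb_iidProb_outputDist_lt hμ hW hY hθ0 hθ hk n
      have b3 : Real.exp (n * (-(4 * εA))) ≤ Real.exp (n * (-(1.5 * εA))) := by
        gcongr
        norm_num
      rw [show θ ^ 2 / 4 = 1.5 * εA by rw [hθε]; ring] at b2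
      linarith
    calc _ ≤ Real.exp (n * (h + τ)) * (2 * Real.exp (n * (-(1.5 * εA)))) :=
          (sum_mul_card_likelyOutputsWith_le hμ.1 hW0 _ _).trans (by gcongr)
      _ = 2 * Real.exp L * Real.exp (n * (τ + e + η - 1.5 * εA))
            * Real.exp (n * (h - e - η) - L) := by
          rw [mul_left_comm, ← Real.exp_add, mul_assoc 2, mul_assoc 2, ← Real.exp_add,
            ← Real.exp_add]
          ring_nf
      _ ≤ _ := by gcongr
  · rw [div_le_iff₀ (by positivity)]
    calc _ ≤ Real.exp (n * (hY' + k)) * |α' n| := by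
          gcongr
          exact card_likelySet_le n (outputDist_mem_stdSimplex hμ hW) _
      _ = Real.exp (2 * L) * |α' n| * Real.exp (n * (k + e - e' + 2 * η))
            * (Real.exp (n * (h - e - η) - L) * Real.exp (n * (hY' - h + e' - η) - L)) := by
          have : Real.exp (n * (hY' + k)) = Real.exp (2 * L)
              * Real.exp (n * (k + e - e' + 2 * η))
              * (Real.exp (n * (h - e - η) - L) * Real.exp (n * (hY' - h + e' - η) - L)) := by
            simp only [← Real.exp_add]; ring_nf
          rw [this]; ring
      _ ≤ _ := by gcongr

/-- The terms `γ` and `-√(2γ) log √(2γ)` of `zeta` are nonnegative here and are dropped. This turns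
the hypothesis on `εA` and `εB` into the deviation allowed for the self-information. -/
theorem mul_log_two_zeta {Y : Type*} [Fintype Y] (hY : 1 ≤ Fintype.card Y) {γ : ℝ} (hγ : 0 < γ)
    (h1 : √(2 * γ) ≤ 1) :
    √(2 * γ) * Real.log (Fintype.card Y) ≤ zeta Y γ * Real.log 2 := by
  have h2 : 0 < Real.log 2 := Real.log_pos one_lt_two
  have hs : 0 < √(2 * γ) := by positivity
  have hN : (0 : ℝ) < Fintype.card Y := by exact_mod_cast hY
  rw [zeta, sub_mul, mul_assoc, Real.logb, div_mul_cancel₀ _ h2.ne',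
    Real.log_div hs.ne' hN.ne']
  have : Real.log √(2 * γ) ≤ 0 := Real.log_nonpos hs.le h1
  nlinarith [mul_pos hγ h2]

/-- For `ε > 0` the logarithm of the quotient splits, leaving an expression continuous at 0 because
`x log x` is. -/
theorem tendsto_zeta_zero (Y : Type*) [Fintype Y] [Nonempty Y] :
    Tendsto (fun ε : ℝ => zeta Y (3 * ε)) (𝓝[>] 0) (𝓝 0) := by
  have hN : (0 : ℝ) < Fintype.card Y := by exact_mod_cast Fintype.card_pos
  have e : ∀ ε ∈ Set.Ioi (0 : ℝ), zeta Y (3 * ε) = 3 * ε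
      + (Real.negMulLog √(2 * (3 * ε)) + √(2 * (3 * ε)) * Real.log (Fintype.card Y))
        / Real.log 2 := by
    intro ε hε
    have hs : 0 < √(2 * (3 * ε)) := by
      have := Set.mem_Ioi.1 hε
      positivity
    rw [zeta, Real.logb, Real.log_div hs.ne' hN.ne', Real.negMulLog]
    ring
  have hc : Continuous fun ε : ℝ => 3 * ε
      + (Real.negMulLog √(2 * (3 * ε)) + √(2 * (3 * ε)) * Real.log (Fintype.card Y))
        / Real.log 2 := by
    have := Real.continuous_negMulLog
    fun_prop
  have h0 := hc.tendsto 0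
  simp only [mul_zero, Real.sqrt_zero, Real.negMulLog_zero, zero_mul, add_zero, zero_div] at h0
  exact (h0.mono_left nhdsWithin_le_nhds).congr' (by
    filter_upwards [self_mem_nhdsWithin] with ε hε using (e ε hε).symm)

/-- The coding theorem. -/
theorem eventually_exists_code (hμ : μ ∈ stdSimplex ℝ X) (hW : ∀ x, W x ∈ stdSimplex ℝ Y)
    (hρ : ∀ x y, 0 ≤ ρ x y) {εA εB : ℝ} (hεA : 0 < εA) (hε : εA + 2 * zeta Y (3 * εA) < εB)
    {lA lB : ℕ → ℕ} (hlA : IsBlockLength Y lA (condEntropy μ W - εA))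
    (hlB : IsBlockLength Y lB (mutualInfo μ W + εB))
    (𝒜 : ∀ n, Ensemble (Fin n → Y) (Fin (lA n) → Y))
    (ℬ : ∀ n, Ensemble (Fin n → Y) (Fin (lB n) → Y))
    {α β α' β' : ℕ → ℝ} (hA : HasHashProperty 𝒜 α β) (hB : HasHashProperty ℬ α' β') :
    ∀ᶠ n : ℕ in atTop, ∀ gA gAB, IsEncoderArgmax W gA →
      IsDecoderArgmax (outputDist μ W) gAB →
      ∃ A ∈ (𝒜 n).carrier, ∃ B ∈ (ℬ n).carrier, ∃ c ∈ (𝒜 n).im,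
        codeDistortion μ ρ (fun x => B (gA A c x)) (fun b => gAB A B c b) ≤
          expDist μ W ρ + 3 * (Fintype.card X : ℝ) * (Fintype.card Y : ℝ) * rhoMax ρ * √εA := by
  have hY := hlA.two_le_card
  have : Nonempty Y := Fintype.card_pos_iff.1 (by omega)
  have hX : 1 ≤ Fintype.card X := by
    by_contra! hc
    have := Fintype.card_eq_zero_iff.1 (Nat.lt_one_iff.1 hc)
    simpa using hμ.2
  have hX' : (1 : ℝ) ≤ Fintype.card X := by exact_mod_cast hX
  have hY' : (2 : ℝ) ≤ Fintype.card Y := by exact_mod_cast hY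
  have hXY : (2 : ℝ) ≤ (Fintype.card X : ℝ) * Fintype.card Y := by nlinarith
  have hs0 : 0 < √εA := Real.sqrt_pos.2 hεA
  have hR0 := rhoMax_nonneg hρ
  have hE0 := expDist_nonneg hμ hW hρ
  -- If the allowed excess is at least `ρ_max`, every code qualifies. Otherwise `|X| |Y| ≥ 2` gives
  -- `6 √εA < 1`, which puts `εA` in the range of the Chernoff bounds.
  by_cases hR : rhoMax ρ ≤ 3 * (Fintype.card X : ℝ) * (Fintype.card Y : ℝ) * rhoMax ρ * √εA
  · filter_upwards [eventually_ge_atTop 1] with n hn gA gAB _ _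
    obtain ⟨A, hAm⟩ := (𝒜 n).carrier_nonempty
    obtain ⟨B, hBm⟩ := (ℬ n).carrier_nonempty
    refine ⟨A, hAm, B, hBm, A (Classical.arbitrary _), ⟨A, hAm, _, rfl⟩, ?_⟩
    linarith [codeDistortion_le_rhoMax (ρ := ρ) hμ hn
      (fun x => B (gA A (A (Classical.arbitrary _)) x))
      (fun b => gAB A B (A (Classical.arbitrary _)) b)]
  push Not at hR
  have hRpos : 0 < rhoMax ρ := by
    rcases hR0.eq_or_lt with h | h
    · rw [← h] at hR; simp at hR
    · exact h
  have hsmall : 6 * √εA < 1 := by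
    have h1 : 6 * √εA * rhoMax ρ ≤
        3 * (Fintype.card X : ℝ) * (Fintype.card Y : ℝ) * rhoMax ρ * √εA := by
      have := mul_le_mul_of_nonneg_right hXY (mul_pos hRpos hs0).le
      nlinarith
    by_contra! hc
    nlinarith
  have hεsq : εA = √εA ^ 2 := (Real.sq_sqrt hεA.le).symm
  have hθ : √(2 * (3 * εA)) ≤ 1 / 2 := by
    rw [Real.sqrt_le_left (by norm_num)]
    nlinarith
  have hk := mul_log_two_zeta (Y := Y) (by omega) (γ := 3 * εA) (by positivity) (by linarith)
  have h2 : 0 < Real.log 2 := Real.log_pos one_lt_two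
  -- The error probability is taken below `√εA`: the total excess is then `(4 + 1) ρ_max √εA`,
  -- within `3 |X| |Y| ρ_max √εA` since `|X| |Y| ≥ 2`.
  obtain ⟨h, τ, k', hev⟩ := eventually_exists_error_le hμ hW hρ hRpos (εA := εA) (εB := εB)
    (θ := √(2 * (3 * εA))) (k := 2 * zeta Y (3 * εA) * Real.log 2) hεA (by linarith)
    (Real.sqrt_nonneg _) hθ (by rw [Real.sq_sqrt (by positivity)]; ring) (by linarith)
    (by nlinarith) hlA hlB 𝒜 ℬ hA hB hs0
  filter_upwards [hev, eventually_ge_atTop 1] with n hn hn1 gA gAB hgA hgAB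
  obtain ⟨A, hAm, B, hBm, c, hc, hle⟩ := hn gA
  refine ⟨A, hAm, B, hBm, c, hc,
    (codeDistortion_le_add (h := h) (τ := τ) (k := k')
      (d := expDist μ W ρ + 4 * √εA * rhoMax ρ) hμ hρ hn1 hgA hgAB (by positivity) A B c).trans ?_⟩
  have h1 := mul_le_mul_of_nonneg_left hle hR0
  have h3 := mul_le_mul_of_nonneg_right hXY (mul_pos hRpos hs0).le
  nlinarith [mul_pos hRpos hs0]

end Coding

end LossyHash

/-! ### The main theorem -/

theorem mainTheorem8 {X Y : Type*} [Fintype X] [Fintype Y]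
    (μ : X → ℝ) (hμ : μ ∈ stdSimplex ℝ X)
    (W : X → Y → ℝ) (hW : ∀ x, W x ∈ stdSimplex ℝ Y)
    (ρ : X → Y → ℝ) (hρ : ∀ x y, 0 ≤ ρ x y) :
    -- the coding theorem
    (∀ εA εB : ℝ, 0 < εA → 0 < εB → εA + 2 * LossyHash.zeta Y (3 * εA) < εB →
      ∀ lA lB : ℕ → ℕ,
      LossyHash.IsBlockLength Y lA (LossyHash.condEntropy μ W - εA) →
      LossyHash.IsBlockLength Y lB (LossyHash.mutualInfo μ W + εB) →
      ∀ (𝒜 : ∀ n, LossyHash.Ensemble (Fin n → Y) (Fin (lA n) → Y))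
        (ℬ : ∀ n, LossyHash.Ensemble (Fin n → Y) (Fin (lB n) → Y)),
      (∃ α β : ℕ → ℝ, LossyHash.HasHashProperty 𝒜 α β) →
      (∃ α β : ℕ → ℝ, LossyHash.HasHashProperty ℬ α β) →
      ∀ᶠ n : ℕ in Filter.atTop, ∀ gA gAB,
        LossyHash.IsEncoderArgmax W gA →
        LossyHash.IsDecoderArgmax (LossyHash.outputDist μ W) gAB →
        ∃ A ∈ (𝒜 n).carrier, ∃ B ∈ (ℬ n).carrier, ∃ c ∈ (𝒜 n).im,
          |LossyHash.codeRate Y n (lB n) - (LossyHash.mutualInfo μ W + εB)|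
            < Real.logb 2 (Fintype.card Y : ℝ) / n ∧
          ((∃ k : ℕ, (k : ℝ) * Real.logb 2 (Fintype.card Y : ℝ)
              = n * (LossyHash.mutualInfo μ W + εB)) →
            LossyHash.codeRate Y n (lB n) = LossyHash.mutualInfo μ W + εB) ∧
          LossyHash.codeDistortion μ ρ (fun x => B (gA A c x)) (fun b => gAB A B c b) ≤
            LossyHash.expDist μ W ρ
              + 3 * (Fintype.card X : ℝ) * (Fintype.card Y : ℝ) * LossyHash.rhoMax ρ
                * Real.sqrt εA) ∧
    -- approaching the rate-distortion bound as `εA, εB → 0`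
    (∀ D : ℝ, LossyHash.AttainsRD μ W ρ D → ∀ δ : ℝ, 0 < δ →
      ∃ ε₀ : ℝ, 0 < ε₀ ∧
      ∀ εA εB : ℝ, 0 < εA → εA < ε₀ → 0 < εB → εB < ε₀ →
      εA + 2 * LossyHash.zeta Y (3 * εA) < εB →
      ∀ lA lB : ℕ → ℕ,
      LossyHash.IsBlockLength Y lA (LossyHash.condEntropy μ W - εA) →
      LossyHash.IsBlockLength Y lB (LossyHash.mutualInfo μ W + εB) →
      ∀ (𝒜 : ∀ n, LossyHash.Ensemble (Fin n → Y) (Fin (lA n) → Y))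
        (ℬ : ∀ n, LossyHash.Ensemble (Fin n → Y) (Fin (lB n) → Y)),
      (∃ α β : ℕ → ℝ, LossyHash.HasHashProperty 𝒜 α β) →
      (∃ α β : ℕ → ℝ, LossyHash.HasHashProperty ℬ α β) →
      ∀ᶠ n : ℕ in Filter.atTop, ∀ gA gAB,
        LossyHash.IsEncoderArgmax W gA →
        LossyHash.IsDecoderArgmax (LossyHash.outputDist μ W) gAB →
        ∃ A ∈ (𝒜 n).carrier, ∃ B ∈ (ℬ n).carrier, ∃ c ∈ (𝒜 n).im,
          |LossyHash.codeRate Y n (lB n) - LossyHash.rateDistortion μ ρ D| ≤ δ ∧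
          LossyHash.codeDistortion μ ρ (fun x => B (gA A c x)) (fun b => gAB A B c b)
            ≤ D + δ) ∧
    -- the condition on `εA, εB` admits arbitrarily small pairs
    (∀ ε₀ : ℝ, 0 < ε₀ → ∃ εA εB : ℝ, 0 < εA ∧ εA < ε₀ ∧ 0 < εB ∧ εB < ε₀ ∧
      εA + 2 * LossyHash.zeta Y (3 * εA) < εB) := by
  have hXne : Nonempty X := by
    by_contra hc
    have := not_nonempty_iff.1 hc
    simpa using hμ.2
  have : Nonempty Y := by
    by_contra hc
    have := not_nonempty_iff.1 hc
    simpa using (hW (Classical.arbitrary X)).2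
  refine ⟨?_, ?_, ?_⟩
  · rintro εA εB hεA - hε lA lB hlA hlB 𝒜 ℬ ⟨α, β, hA⟩ ⟨α', β', hB⟩
    filter_upwards [LossyHash.eventually_exists_code hμ hW hρ hεA hε hlA hlB 𝒜 ℬ hA hB,
      Filter.eventually_ge_atTop 1] with n hn hn1 gA gAB hgA hgAB
    obtain ⟨A, hAm, B, hBm, c, hc, hle⟩ := hn gA gAB hgA hgAB
    exact ⟨A, hAm, B, hBm, c, hc, LossyHash.abs_codeRate_sub_lt hlB hn1,
      fun ⟨_, hk⟩ => LossyHash.codeRate_eq hlB hn1 hk, hle⟩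
  · intro D hD δ hδ
    have hlim : Filter.Tendsto (fun ε : ℝ => 3 * (Fintype.card X : ℝ) * (Fintype.card Y : ℝ)
        * LossyHash.rhoMax ρ * Real.sqrt ε) (nhds 0) (nhds 0) := by
      have hc : Continuous fun ε : ℝ => 3 * (Fintype.card X : ℝ) * (Fintype.card Y : ℝ)
        * LossyHash.rhoMax ρ * Real.sqrt ε := by fun_prop
      simpa using hc.tendsto 0
    obtain ⟨ε₁, hε₁, hball⟩ := Metric.eventually_nhds_iff.1 (hlim.eventually_le_const hδ)
    -- `ε₁` controls the distortion excess; the rate error is `εB < δ / 2` plus a rounding error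
    -- eventually below `δ / 2`.
    refine ⟨min ε₁ (δ / 2), lt_min hε₁ (half_pos hδ), ?_⟩
    rintro εA εB hεA hεA' hεB hεB' hε lA lB hlA hlB 𝒜 ℬ ⟨α, β, hA⟩ ⟨α', β', hB⟩
    have hsmall := hball (y := εA) (by
      rw [Real.dist_eq, sub_zero, abs_of_pos hεA]
      exact hεA'.trans_le (min_le_left _ _))
    have hrate := (tendsto_const_div_atTop_nhds_zero_nat
      (Real.logb 2 (Fintype.card Y : ℝ))).eventually_lt_const (half_pos hδ)
    filter_upwards [LossyHash.eventually_exists_code hμ hW hρ hεA hε hlA hlB 𝒜 ℬ hA hB,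
      Filter.eventually_ge_atTop 1, hrate] with n hn hn1 hr gA gAB hgA hgAB
    obtain ⟨A, hAm, B, hBm, c, hc, hle⟩ := hn gA gAB hgA hgAB
    refine ⟨A, hAm, B, hBm, c, hc, ?_, by linarith [hD.1]⟩
    have hR := abs_lt.1 (LossyHash.abs_codeRate_sub_lt hlB hn1)
    have := min_le_right ε₁ (δ / 2)
    rw [← hD.2, abs_le]
    constructor <;> linarith [hR.1, hR.2]
  · intro ε₀ hε₀
    have hlim : Filter.Tendsto (fun ε : ℝ => ε + 2 * LossyHash.zeta Y (3 * ε))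
        (nhdsWithin 0 (Set.Ioi 0)) (nhds 0) := by
      simpa using (Filter.tendsto_id.mono_left nhdsWithin_le_nhds).add
        ((LossyHash.tendsto_zeta_zero Y).const_mul 2)
    obtain ⟨ε, hε, hε', hpos⟩ := ((hlim.eventually_lt_const (half_pos hε₀)).and
      ((Filter.Tendsto.mono_left Filter.tendsto_id nhdsWithin_le_nhds
        |>.eventually_lt_const hε₀).and self_mem_nhdsWithin)).exists
    -- `εB` is fixed at `ε₀ / 2` and `εA` is taken small enough relative to it.
    exact ⟨ε, ε₀ / 2, hpos, hε', half_pos hε₀, half_lt_self hε₀, hε⟩
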